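/- Let $m\ge 2$. There is a constant $C>0$ depending only on $m$ such that the following holds. Setting. Let $\mathcal M\subset\mathbb R^d$ be a compact, connected, smooth, embedded $m$-dimensional submanifold without boundary, with the induced Riemannian metric, volume measure $\mathcal V$ and geodesic distance $d(\cdot,\cdot)$; write $\mathcal B(x,r)$ for the open geodesic ball and $|\cdot|$ for the Euclidean norm. Let $\mu=p\,d\mathcal V$ be a probability measure with $p\in C^2(\mathcal M)$ and $p>0$, and let $x_1,\dots,x_n$ be i.i.d. samples from $\mu$, $X=\{x_1,\dots,x_n\}$, $1\le k<n$. Let $\alpha$ be the volume of the unit ball of $\mathbb R^m$, $\eta=1_{[0,1]}$, and for $x,y\in\mathcal M$ $$\varepsilon_k(x)=\min\{\epsilon>0:\ \#\{i:0<|x_i-x|\le\epsilon\}\ge k\},\qquad N(x,y)=\#\{i:\ x_i\ne x,y,\ |x-x_i|\le\varepsilon_k(x),\ |y-x_i|\le\varepsilon_k(y)\},$$ $$w_k(x,y)=\int_{\mathcal M}\eta\Big(\frac{d(x,z)}{\varepsilon_k(x)}\Big)\eta\Big(\frac{d(y,z)}{\varepsilon_k(y)}\Big)p(z)\,d\mathcal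 V(z).$$ For $u:X\to\mathbb R$ and $x\in X$ put $$\mathcal L^{snn}u(x)=\frac{(\alpha n/k)^{1+2/m}}{2^{m+2}n}\sum_{i=1}^n\frac{N(x,x_i)}{k}(u(x)-u(x_i)),\qquad \mathcal L^{1}u(x)=\frac{(\alpha n/k)^{1+2/m}}{2^{m+2}k}\sum_{i=1}^n w_k(x,x_i)(u(x)-u(x_i)).$$ Define $\varepsilon(x)$ by $k/n=\alpha p(x)\varepsilon(x)^m$ and let $\varepsilon^\star=\max_{x\in\mathcal M}\varepsilon(x)$. For $f$ Lipschitz with respect to $d$ and $S\subset\mathcal M$ let $[f]_{1;S}=\sup_{y\ne z\in S}|f(y)-f(z)|/d(y,z)$. Claim. For every $A>2$ there are constants $C_p,c_p,\kappa_p>0$, depending only on $\mathcal M$, $p$ and $A$, such that for all $n$, all $1\le k<n$, every Lipschitz $f:\mathcal M\to\mathbb R$ with $u=f|_X$, every sample point $x=x_j\in X$, and every $t$ with $(k/n)^{1/m}\le t\le (k/n)^{-1/m}$: 1. $\displaystyle \mathbb P\big(|\mathcal L^{snn}u(x)-\mathcal L^1u(x)|> C_p\,[f]_{1;\mathcal M}\,t\big)\le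 C\,n\exp\big(-c_p\,k\,(k/n)^{2/m}t^2\big);$ 2. if moreover $k/n\le\kappa_p$, then the seminorm can be localized: $\displaystyle \mathbb P\big(|\mathcal L^{snn}u(x)-\mathcal L^1u(x)|> C_p\,[f]_{1;\mathcal B(x,A\varepsilon^\star)}\,t\big)\le C\,n\exp\big(-c_p\,k\,(k/n)^{2/m}t^2\big).$ -/

import Mathlib

open MeasureTheory ProbabilityTheory Set
open scoped Manifold ContDiff ENNReal

namespace SNN

noncomputable section

/-- The volume `α` of the unit ball of `ℝ^m`. -/
def unitBallVol (m : ℕ) : ℝ :=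
  (volume (Metric.ball (0 : EuclideanSpace ℝ (Fin m)) 1)).toReal

section Geometry

variable {m d : ℕ} {M : Type*} [TopologicalSpace M] [ChartedSpace (EuclideanSpace ℝ (Fin m)) M]

/-- The geodesic distance of the Riemannian metric induced on `M` by the embedding
`ι : M → ℝ^d`: the infimum of the (Euclidean) lengths of the curves `ι ∘ γ`, over all `C^1` curves
`γ : [0,1] → M` from `x` to `y`. -/
def geodDist (ι : M → EuclideanSpace ℝ (Fin d)) (x y : M) : ℝ :=
  (⨅ (γ : ℝ → M) (_ : ContMDiffOn 𝓘(ℝ, ℝ) (𝓡 m) 1 γ (Icc 0 1) ∧ γ 0 = x ∧ γ 1 = y),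
    ∫⁻ t in Icc (0 : ℝ) 1, ‖deriv (ι ∘ γ) t‖ₑ).toReal

/-- The open geodesic ball. -/
def geodBall (ι : M → EuclideanSpace ℝ (Fin d)) (x : M) (r : ℝ) : Set M :=
  {y | geodDist (m := m) ι x y < r}

/-- `f` is Lipschitz for the geodesic distance, i.e. `f ∈ C^{0,1}(M)`. -/
def IsLip (ι : M → EuclideanSpace ℝ (Fin d)) (f : M → ℝ) : Prop :=
  ∃ L : ℝ, ∀ y z : M, |f y - f z| ≤ L * geodDist (m := m) ι y z

/-- The Lipschitz seminorm `[f]_{1;S}`, the supremum of `|f y - f z| / d(y,z)` over `y ≠ z` in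
`S`. It is used for `f` satisfying `IsLip`, where the set of quotients is bounded. -/
def lipSeminorm (ι : M → EuclideanSpace ℝ (Fin d)) (f : M → ℝ) (S : Set M) : ℝ :=
  sSup {q : ℝ | ∃ y ∈ S, ∃ z ∈ S, y ≠ z ∧ q = |f y - f z| / geodDist (m := m) ι y z}

/-- The Riemannian volume of `M` for the metric induced by the embedding `ι`: the `m`-dimensional
Hausdorff measure of `ℝ^d`, normalized so that it is Lebesgue measure on `m`-dimensional
subspaces, pulled back by `ι`. -/
def vol (m : ℕ) {d : ℕ} {M : Type*} [MeasurableSpace M]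
    (ι : M → EuclideanSpace ℝ (Fin d)) : Measure M :=
  Measure.comap ι (Measure.euclideanHausdorffMeasure m)

/-- The measure `p dVol` on `M`. -/
def densityMeasure (m : ℕ) {d : ℕ} {M : Type*} [MeasurableSpace M]
    (ι : M → EuclideanSpace ℝ (Fin d)) (p : M → ℝ) : Measure M :=
  (vol m ι).withDensity (fun x => ENNReal.ofReal (p x))

end Geometry

/-- The step function `1_{[0,1]}`. -/
def eta (t : ℝ) : ℝ := Set.indicator (Icc (0 : ℝ) 1) (fun _ => (1 : ℝ)) t

section Samples

variable {m d n : ℕ} {M : Type*}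

/-- `N_ε(x)`: the number of sample points in the punctured closed Euclidean ball around `x`. -/
def ballCount (ι : M → EuclideanSpace ℝ (Fin d)) (X : Fin n → M) (x : M) (ε : ℝ) : ℕ :=
  Set.ncard {i : Fin n | 0 < dist (ι (X i)) (ι x) ∧ dist (ι (X i)) (ι x) ≤ ε}

/-- `ε_k(x) = min {ε > 0 : N_ε(x) ≥ k}`, the `k`-nearest-neighbor radius at `x`. -/
def knnRadius (ι : M → EuclideanSpace ℝ (Fin d)) (k : ℕ) (X : Fin n → M) (x : M) : ℝ :=
  sInf {ε : ℝ | 0 < ε ∧ k ≤ ballCount ι X x ε}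

/-- `N(x,y)`: the number of sample points other than `x`, `y` that lie in both closed Euclidean
balls `B(x, ε_k(x))` and `B(y, ε_k(y))`. -/
def sharedCount (ι : M → EuclideanSpace ℝ (Fin d)) (k : ℕ) (X : Fin n → M) (x y : M) : ℕ :=
  Set.ncard {i : Fin n | X i ≠ x ∧ X i ≠ y ∧
    dist (ι x) (ι (X i)) ≤ knnRadius ι k X x ∧ dist (ι y) (ι (X i)) ≤ knnRadius ι k X y}

/-- The unnormalized SNN graph Laplacian of the sample `X`, acting on functions `u` on the nodes,
evaluated at the `j`-th node. -/
def snnLaplacian (m : ℕ) (ι : M → EuclideanSpace ℝ (Fin d)) (k : ℕ) (X : Fin n → M)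
    (u : Fin n → ℝ) (j : Fin n) : ℝ :=
  (unitBallVol m * n / k) ^ (1 + 2 / (m : ℝ)) / (2 ^ (m + 2) * n) *
    ∑ i : Fin n, (sharedCount ι k X (X j) (X i) : ℝ) / k * (u j - u i)

/-- `w_k(x,y) = ∫_M η(d(x,z)/ε_k(x)) η(d(y,z)/ε_k(y)) p(z) dVol(z)`. -/
def wk [TopologicalSpace M] [ChartedSpace (EuclideanSpace ℝ (Fin m)) M] [MeasurableSpace M]
    (ι : M → EuclideanSpace ℝ (Fin d)) (p : M → ℝ) (k : ℕ) (X : Fin n → M) (x y : M) : ℝ :=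
  ∫ z, eta (geodDist (m := m) ι x z / knnRadius ι k X x) *
    eta (geodDist (m := m) ι y z / knnRadius ι k X y) * p z ∂(vol m ι)

/-- The operator `L^1`, in which `N(x, x_i)` is replaced by `n w_k(x, x_i)`, evaluated at the
`j`-th sample point. -/
def L1 [TopologicalSpace M] [ChartedSpace (EuclideanSpace ℝ (Fin m)) M] [MeasurableSpace M]
    (ι : M → EuclideanSpace ℝ (Fin d)) (p : M → ℝ) (k : ℕ) (X : Fin n → M)
    (u : Fin n → ℝ) (j : Fin n) : ℝ :=
  (unitBallVol m * n / k) ^ (1 + 2 / (m : ℝ)) / (2 ^ (m + 2) * k) *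
    ∑ i : Fin n, wk (m := m) ι p k X (X j) (X i) * (u j - u i)

/-- `ε* = max_x ε(x)`, where `ε(x)` is given by `k/n = α p(x) ε(x)^m`. -/
def epsStar (m : ℕ) (p : M → ℝ) (k n : ℕ) : ℝ :=
  ⨆ x : M, ((k : ℝ) / n / (unitBallVol m * p x)) ^ (1 / (m : ℝ))

end Samples

end

end SNN

namespace SNN

/-! Put `ε = (k/n)^(1/m)`, so that `ε* = e ε` with `e` depending only on `m` and `min p`. The two
operators differ by a prefactor of order `1/(ε^(m+2) k n)` times the sum of `(N - n w_k)(u_j -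
u_i)`. On a good event all nearest-neighbor radii are at most `R`, slightly more than `ε*`. Then
`O(k)` indices contribute, each increment is `O(ε)` times the seminorm, and `|N - n w_k| = O(k ε
t)`; the product has order `k t / (n ε^m) = t`.

Two errors make up `N - n w_k`. The bias: `N` counts in Euclidean balls, `w_k` integrates over
geodesic ones. Geodesic distance exceeds the chord by at most a cubic term, so the balls differ by a
shell of measure `O(r^(m+2))`, which contributes `n ε^(m+2) = k ε² ≤ k ε t`
(`abs_overlap_sub_wk_le`). The fluctuation: the intersection of two balls is random, but its radii
are distances to two sample points `x_a`, `x_b`. Given `x_j, x_i, x_a, x_b` the set is fixed and the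
other points are i.i.d., so Bernstein's inequality applies with variance of order `k`
(`measure_abs_sum_random_set_ge_le`). The union over `(i, a, b)` costs `n³`. With `z = k ε² t²`,
either `n e^(-cz) ≥ 1` and the claim is trivial, or `n³ e^(-3cz) ≤ n e^(-cz)`.

Localization for every `A > 2` needs a sharp leading constant. By `exists_le_vol_ball`, a ball of
radius `R = (1+δ)³ ε*` has mass at least `(1+δ) k/n` and so catches `k` points; contributing points
lie within chord `2R` of `x_j`, hence within geodesic distance `A ε*`. When `k/n > κ`, the global
estimate is deterministic. -/

/-! ### Quantitative local parametrizations: lengths of curves. -/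

theorem euclideanHausdorffMeasure_le_of_antilipschitzOn {X Y : Type*} [EMetricSpace X]
    [MeasurableSpace X] [BorelSpace X] [EMetricSpace Y] [MeasurableSpace Y] [BorelSpace Y]
    (m : ℕ) {f : X → Y} {s : Set X} {K : NNReal}
    (h : ∀ x ∈ s, ∀ y ∈ s, edist x y ≤ K * edist (f x) (f y)) :
    Measure.euclideanHausdorffMeasure m s
      ≤ (K : ℝ≥0∞) ^ m * Measure.euclideanHausdorffMeasure m (f '' s) := by
  have hf : AntilipschitzWith K (fun x : s => f x) := fun x y => h x x.2 y y.2
  have h1 := hf.le_hausdorffMeasure_image (d := (m : ℝ)) (by positivity) univ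
  have h2 : (fun x : s => f x) '' univ = f '' s := by
    ext y; simp
  rw [h2, ← isometry_subtype_coe.hausdorffMeasure_image (Or.inl (by positivity))] at h1
  simp only [image_univ, Subtype.range_coe_subtype, ofPred_mem_eq, ENNReal.rpow_natCast] at h1
  simp only [Measure.euclideanHausdorffMeasure_def, Measure.smul_apply,
    ENNReal.smul_def, smul_eq_mul]
  rw [mul_left_comm]
  gcongr

/-- Quantitative local parametrization: `ψ` has derivative `D` on a ball, `D` is Lipschitz there
and `ψ` is bounded below. -/
structure LocalParam {E F : Type*} [NormedAddCommGroup E] [NormedSpace ℝ E]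
    [NormedAddCommGroup F] [NormedSpace ℝ F] (ψ : E → F) (D : E → E →L[ℝ] F) (a₀ : E)
    (ρ c K : ℝ) : Prop where
  rho_pos : 0 < ρ
  c_pos : 0 < c
  K_pos : 0 < K
  hasFDerivAt : ∀ a ∈ Metric.ball a₀ ρ, HasFDerivAt ψ (D a) a
  lip : ∀ a ∈ Metric.ball a₀ ρ, ∀ b ∈ Metric.ball a₀ ρ, ‖D a - D b‖ ≤ K * ‖a - b‖
  antilip : ∀ a ∈ Metric.ball a₀ ρ, ∀ b ∈ Metric.ball a₀ ρ, c * ‖a - b‖ ≤ ‖ψ a - ψ b‖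

namespace LocalParam

section Normed

variable {E F : Type*} [NormedAddCommGroup E] [NormedSpace ℝ E]
    [NormedAddCommGroup F] [NormedSpace ℝ F] {ψ : E → F} {D : E → E →L[ℝ] F} {a₀ : E}
    {ρ c K : ℝ}

theorem norm_sub_sub_le (h : LocalParam ψ D a₀ ρ c K) {s : Set E} (hs : Convex ℝ s)
    (hsρ : s ⊆ Metric.ball a₀ ρ) {a b b' : E} (ha : a ∈ Metric.ball a₀ ρ) (hb : b ∈ s)
    (hb' : b' ∈ s) {σ : ℝ} (hσ : ∀ y ∈ s, ‖y - a‖ ≤ σ) :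
    ‖ψ b - ψ b' - D a (b - b')‖ ≤ K * σ * ‖b - b'‖ := by
  refine hs.norm_image_sub_le_of_norm_hasFDerivWithin_le' (f' := D)
    (fun x hx => (h.hasFDerivAt x (hsρ hx)).hasFDerivWithinAt) (fun x hx => ?_) hb' hb
  refine (h.lip x (hsρ hx) a ha).trans ?_
  exact mul_le_mul_of_nonneg_left (hσ x hx) h.K_pos.le

/-- All points of the segment lie within `‖b - a‖` of `e`, so the mean value bound holds with `σ =
‖b - a‖` for any base point `e` on it. -/
theorem norm_sub_sub_le_sq (h : LocalParam ψ D a₀ ρ c K) {a b e : E}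
    (ha : a ∈ Metric.ball a₀ ρ) (hb : b ∈ Metric.ball a₀ ρ) (he : e ∈ segment ℝ a b) :
    ‖ψ b - ψ a - D e (b - a)‖ ≤ K * ‖b - a‖ * ‖b - a‖ := by
  have hsub := (convex_ball a₀ ρ).segment_subset ha hb
  refine h.norm_sub_sub_le (convex_segment a b) hsub (hsub he) (right_mem_segment ℝ a b)
    (left_mem_segment ℝ a b) (fun y hy => ?_)
  obtain ⟨s, hs, rfl⟩ := (segment_eq_image' ℝ a b ▸ hy)
  obtain ⟨t, ht, rfl⟩ := (segment_eq_image' ℝ a b ▸ he)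
  rw [add_sub_add_left_eq_sub, ← sub_smul, norm_smul]
  refine mul_le_of_le_one_left (norm_nonneg _) ?_
  rw [Real.norm_eq_abs, abs_le]
  constructor <;> linarith [hs.1, hs.2, ht.1, ht.2]

/-- Divide `antilip` for `a + t • w` and `a` by `t` and let `t → 0+`; the linearization error is
`O(t)`. -/
theorem le_norm_apply (h : LocalParam ψ D a₀ ρ c K) {a : E} (ha : a ∈ Metric.ball a₀ ρ) (w : E) :
    c * ‖w‖ ≤ ‖D a w‖ := by
  have h1 : Filter.Tendsto (fun t : ℝ => c * ‖w‖ - K * t * ‖w‖ * ‖w‖) (nhdsWithin 0 (Ioi 0))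
      (nhds (c * ‖w‖)) := by
    have : Continuous (fun t : ℝ => c * ‖w‖ - K * t * ‖w‖ * ‖w‖) := by fun_prop
    simpa using (this.tendsto 0).mono_left nhdsWithin_le_nhds
  refine le_of_tendsto h1 ?_
  have h2 : ∀ᶠ t : ℝ in nhds 0, a + t • w ∈ Metric.ball a₀ ρ := by
    have : Continuous (fun t : ℝ => a + t • w) := by fun_prop
    exact this.tendsto 0 (Metric.isOpen_ball.mem_nhds (by simpa using ha))
  filter_upwards [h2.filter_mono nhdsWithin_le_nhds, self_mem_nhdsWithin] with t ht ht0
  have ht0 : 0 < t := ht0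
  have e1 := h.norm_sub_sub_le_sq ha ht (left_mem_segment ℝ _ _)
  have e2 := h.antilip _ ht a ha
  simp only [add_sub_cancel_left, norm_smul, map_smul, Real.norm_eq_abs, abs_of_pos ht0] at e1 e2
  have e3 : ‖ψ (a + t • w) - ψ a‖ ≤ ‖ψ (a + t • w) - ψ a - t • D a w‖ + t * ‖D a w‖ := by
    have := norm_add_le (ψ (a + t • w) - ψ a - t • D a w) (t • D a w)
    simpa [norm_smul, abs_of_pos ht0] using this
  have : t * (c * ‖w‖ - K * t * ‖w‖ * ‖w‖) ≤ t * ‖D a w‖ := by nlinarith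
  exact le_of_mul_le_mul_left this ht0

end Normed

section Inner

variable {E F : Type*} [NormedAddCommGroup E] [NormedSpace ℝ E]
    [NormedAddCommGroup F] [InnerProductSpace ℝ F] {ψ : E → F} {D : E → E →L[ℝ] F} {a₀ : E}
    {ρ c K : ℝ}

/-- For `e` a chord and `v` a velocity, the linear term integrates exactly to the chord length and
`v - e` enters only squared. This turns a quadratic linearization error into a cubic excess of
length. -/
theorem norm_le_of_inner (e v : F) (he : e ≠ 0) :
    ‖v‖ ≤ inner ℝ e v / ‖e‖ + ‖v - e‖ ^ 2 / (2 * ‖e‖) := by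
  have he' : 0 < ‖e‖ := norm_pos_iff.2 he
  have h1 := norm_sub_sq_real v e
  rw [real_inner_comm] at h1
  have h2 : inner ℝ e v / ‖e‖ + ‖v - e‖ ^ 2 / (2 * ‖e‖) = (‖v‖ ^ 2 + ‖e‖ ^ 2) / (2 * ‖e‖) := by
    rw [h1]; field_simp; ring
  rw [h2, le_div_iff₀ (by positivity)]
  nlinarith [sq_nonneg (‖v‖ - ‖e‖)]

/-- The image of a segment under a local parametrization is longer than its chord by at most a
cubic term. -/
theorem lintegral_enorm_le (h : LocalParam ψ D a₀ ρ c K) {a b : E}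
    (ha : a ∈ Metric.ball a₀ ρ) (hb : b ∈ Metric.ball a₀ ρ) :
    ∫⁻ t in Icc (0 : ℝ) 1, ‖D (a + t • (b - a)) (b - a)‖ₑ
      ≤ ENNReal.ofReal (‖ψ b - ψ a‖ + K ^ 2 / (2 * c ^ 4) * ‖ψ b - ψ a‖ ^ 3) := by
  rcases eq_or_ne a b with rfl | hab
  · simp
  have hc := h.c_pos
  have hseg : ∀ t ∈ Icc (0 : ℝ) 1, a + t • (b - a) ∈ Metric.ball a₀ ρ := fun t ht =>
    (convex_ball a₀ ρ).segment_subset ha hb (segment_eq_image' ℝ a b ▸ ⟨t, ht, rfl⟩)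
  set e := ψ b - ψ a with he
  have hw : 0 < ‖b - a‖ := norm_pos_iff.2 (sub_ne_zero.2 hab.symm)
  have hew : c * ‖b - a‖ ≤ ‖e‖ := h.antilip b hb a ha
  have he0 : 0 < ‖e‖ := lt_of_lt_of_le (by positivity) hew
  set q : ℝ := (K * ‖b - a‖ * ‖b - a‖) ^ 2 / (2 * ‖e‖) with hq
  -- `‖b - a‖^4 ≤ (‖e‖ / c)^4`, and one factor cancels against the denominator: the origin of the
  -- cube.
  have hqle : q ≤ K ^ 2 / (2 * c ^ 4) * ‖e‖ ^ 3 := by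
    have h4 : (c * ‖b - a‖) ^ 4 ≤ ‖e‖ ^ 4 := by gcongr
    rw [hq, div_le_iff₀ (by positivity)]
    have : K ^ 2 / (2 * c ^ 4) * ‖e‖ ^ 3 * (2 * ‖e‖) = K ^ 2 * ‖e‖ ^ 4 / c ^ 4 := by
      field_simp
    rw [this, le_div_iff₀ (by positivity)]
    calc (K * ‖b - a‖ * ‖b - a‖) ^ 2 * c ^ 4 = K ^ 2 * (c * ‖b - a‖) ^ 4 := by ring
      _ ≤ _ := by gcongr
  let g : ℝ → ℝ := fun t => inner ℝ e (D (a + t • (b - a)) (b - a)) / ‖e‖ + q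
  have hpt : ∀ t ∈ Icc (0 : ℝ) 1, ‖D (a + t • (b - a)) (b - a)‖ ≤ g t := by
    intro t ht
    refine (norm_le_of_inner e _ (norm_pos_iff.1 he0)).trans ?_
    have := h.norm_sub_sub_le_sq ha hb (segment_eq_image' ℝ a b ▸ ⟨t, ht, rfl⟩ : a + t • (b - a) ∈ _)
    rw [← he, norm_sub_rev] at this
    simp only [g, hq]
    gcongr
  have hder : ∀ t ∈ Icc (0 : ℝ) 1,
      HasDerivAt (fun t : ℝ => inner ℝ e (ψ (a + t • (b - a))) / ‖e‖ + q * t) (g t) t := by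
    intro t ht
    have h1 : HasDerivAt (fun t : ℝ => a + t • (b - a)) (b - a) t := by
      simpa using ((hasDerivAt_id t).smul_const (b - a)).const_add a
    have h2 := (h.hasFDerivAt _ (hseg t ht)).comp_hasDerivAt t h1
    have h3 := (((hasDerivAt_const t e).inner ℝ h2).div_const ‖e‖).add
      ((hasDerivAt_id t).const_mul q)
    exact h3.congr_deriv (by simp [g])
  have hcont : ContinuousOn g (Icc 0 1) := by
    have hD : ContinuousOn D (Metric.ball a₀ ρ) := by
      have : LipschitzOnWith K.toNNReal D (Metric.ball a₀ ρ) := by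
        refine LipschitzOnWith.of_dist_le_mul fun x hx y hy => ?_
        rw [dist_eq_norm, dist_eq_norm, Real.coe_toNNReal _ h.K_pos.le]
        exact h.lip x hx y hy
      exact this.continuousOn
    have h1 : ContinuousOn (fun t : ℝ => D (a + t • (b - a))) (Icc 0 1) :=
      hD.comp (by fun_prop) hseg
    have h2 : ContinuousOn (fun t : ℝ => D (a + t • (b - a)) (b - a)) (Icc 0 1) :=
      h1.clm_apply continuousOn_const
    exact ((continuousOn_const.inner h2).div_const _).add continuousOn_const
  have hint : ∫ t in Icc (0 : ℝ) 1, g t = ‖e‖ + q := by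
    rw [integral_Icc_eq_integral_Ioc, ← intervalIntegral.integral_of_le zero_le_one,
      intervalIntegral.integral_eq_sub_of_hasDerivAt (fun t ht => hder t (by simpa using ht))
        (ContinuousOn.intervalIntegrable (by simpa using hcont))]
    simp only [one_smul, add_sub_cancel, zero_smul, add_zero, mul_one, mul_zero]
    rw [add_sub_right_comm, ← sub_div, ← inner_sub_right, ← he, real_inner_self_eq_norm_sq]
    field_simp
  calc ∫⁻ t in Icc (0 : ℝ) 1, ‖D (a + t • (b - a)) (b - a)‖ₑ
      ≤ ∫⁻ t in Icc (0 : ℝ) 1, ENNReal.ofReal (g t) := by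
        refine setLIntegral_mono' measurableSet_Icc fun t ht => ?_
        rw [← ofReal_norm]
        exact ENNReal.ofReal_le_ofReal (hpt t ht)
    _ = ENNReal.ofReal (∫ t in Icc (0 : ℝ) 1, g t) := by
        rw [ofReal_integral_eq_lintegral_ofReal (hcont.integrableOn_Icc)]
        exact (ae_restrict_iff' measurableSet_Icc).2
          (Filter.Eventually.of_forall fun t ht => (norm_nonneg _).trans (hpt t ht))
    _ ≤ _ := by
        rw [hint]; exact ENNReal.ofReal_le_ofReal (by linarith)

end Inner

end LocalParam

/-! ### Tangent spaces read in the parameter space, and volume comparison. -/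

section LinearAlgebra

variable {E F : Type*} [NormedAddCommGroup E] [InnerProductSpace ℝ E] [FiniteDimensional ℝ E]
  [NormedAddCommGroup F] [InnerProductSpace ℝ F]

/-- The orthogonal projection onto the range of an injective linear map, read in the domain. -/
theorem exists_projection_range (L : E →L[ℝ] F) (hL : Function.Injective L) :
    ∃ P : F →ₗ[ℝ] E, ∀ z w, ‖z‖ ^ 2 ≤ ‖P z‖ ^ 2 + ‖z - L w‖ ^ 2 ∧ ‖P z‖ ≤ ‖z‖ := by
  let T : Submodule ℝ F := LinearMap.range (L : E →ₗ[ℝ] F)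
  have hfr : Module.finrank ℝ T = Module.finrank ℝ E := LinearMap.finrank_range_of_inj hL
  -- Injectivity gives range and domain the same dimension, so the projection can take values in
  -- `E`, where Hausdorff measure is Lebesgue measure.
  let e : T ≃ₗᵢ[ℝ] E := (stdOrthonormalBasis ℝ T).equiv (stdOrthonormalBasis ℝ E) (finCongr hfr)
  refine ⟨(e.toLinearEquiv : T →ₗ[ℝ] E) ∘ₗ (T.orthogonalProjectionOnto : F →ₗ[ℝ] T),
    fun z w => ?_⟩
  have h0 : ‖((e.toLinearEquiv : T →ₗ[ℝ] E) ∘ₗ (T.orthogonalProjectionOnto : F →ₗ[ℝ] T)) z‖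
      = ‖T.orthogonalProjectionOnto z‖ := e.norm_map _
  rw [h0]
  refine ⟨?_, T.norm_orthogonalProjectionOnto_apply_le z⟩
  have h1 : ‖z‖ ^ 2 = ‖T.orthogonalProjectionOnto z‖ ^ 2 + ‖z - T.starProjection z‖ ^ 2 := by
    have h3 := norm_add_sq_real (T.starProjection z) (z - T.starProjection z)
    rw [add_sub_cancel, real_inner_comm, T.starProjection_inner_eq_zero z (T.starProjection z)
      (T.orthogonalProjectionOnto z).2] at h3
    simpa using h3
  have h2 : ‖z - T.starProjection z‖ ≤ ‖z - L w‖ := by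
    rw [T.starProjection_minimal z]
    exact ciInf_le ⟨0, by rintro _ ⟨x, rfl⟩; positivity⟩ (⟨L w, w, rfl⟩ : T)
  rw [h1]
  gcongr

/-- `Λ` is the projection composed with `L`, which loses no norm on the range. It straightens the
norm pulled back by a derivative into the standard one, so tangent balls become round. -/
theorem exists_linearEquiv_norm_eq (L : E →L[ℝ] F) (hL : Function.Injective L) :
    ∃ Λ : E ≃ₗ[ℝ] E, ∀ w, ‖Λ w‖ = ‖L w‖ := by
  obtain ⟨P, hP⟩ := exists_projection_range L hL
  have h : ∀ w, ‖P (L w)‖ = ‖L w‖ := fun w => by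
    refine le_antisymm (hP (L w) w).2 ?_
    have := (hP (L w) w).1
    simp only [sub_self, norm_zero] at this
    exact (sq_le_sq₀ (norm_nonneg _) (norm_nonneg _)).1 (by simpa using this)
  refine ⟨LinearEquiv.ofInjectiveEndo (P ∘ₗ (L : E →ₗ[ℝ] F)) ?_, fun w => h w⟩
  rw [← LinearMap.ker_eq_bot, LinearMap.ker_eq_bot']
  intro w hw
  have : ‖L w‖ = 0 := by rw [← h w]; simpa using hw
  exact hL (by simpa using this)

end LinearAlgebra

namespace LocalParam

variable {m : ℕ} {F : Type*} [NormedAddCommGroup F] [InnerProductSpace ℝ F]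
  {ψ : EuclideanSpace ℝ (Fin m) → F}
  {D : EuclideanSpace ℝ (Fin m) → EuclideanSpace ℝ (Fin m) →L[ℝ] F}
  {a₀ : EuclideanSpace ℝ (Fin m)} {ρ c K : ℝ}

theorem injective (h : LocalParam ψ D a₀ ρ c K) {a : EuclideanSpace ℝ (Fin m)}
    (ha : a ∈ Metric.ball a₀ ρ) : Function.Injective (D a) := by
  refine (injective_iff_map_eq_zero (D a)).2 fun w hw => ?_
  have h1 := h.le_norm_apply ha w
  rw [hw, norm_zero] at h1
  have := h.c_pos
  by_contra hne
  have : 0 < ‖w‖ := norm_pos_iff.2 hne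
  nlinarith [mul_pos h.c_pos this]

theorem closedBall_subset {a : EuclideanSpace ℝ (Fin m)} (ha : a ∈ Metric.ball a₀ (ρ / 2))
    {σ : ℝ} (hσ : σ < ρ / 2) : Metric.closedBall a σ ⊆ Metric.ball a₀ ρ := by
  refine Metric.closedBall_subset_ball' ?_
  rw [Metric.mem_ball] at ha
  linarith

theorem mem_ball_of_half (h : LocalParam ψ D a₀ ρ c K) {a : EuclideanSpace ℝ (Fin m)}
    (ha : a ∈ Metric.ball a₀ (ρ / 2)) : a ∈ Metric.ball a₀ ρ :=
  Metric.ball_subset_ball (by linarith [h.rho_pos]) ha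

variable [MeasurableSpace F] [BorelSpace F]

/-- Sharp lower bound for the volume of small Euclidean balls. -/
theorem volume_closedBall_le (h : LocalParam ψ D a₀ ρ c K) {δ : ℝ} (hδ : 0 < δ) :
    ∃ r₂ > 0, ∀ a ∈ Metric.ball a₀ (ρ / 2), ∀ r, 0 ≤ r → r ≤ r₂ →
      volume (Metric.closedBall (0 : EuclideanSpace ℝ (Fin m)) r) ≤
        ENNReal.ofReal (1 + δ) ^ m * Measure.euclideanHausdorffMeasure m
          {y ∈ ψ '' Metric.ball a₀ ρ | ‖y - ψ a‖ ≤ (1 + δ) * r} := by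
  have hc := h.c_pos
  have hK := h.K_pos
  have hρ := h.rho_pos
  -- The first bound makes the relative linearization error at most `δ`; the second keeps the ball
  -- of radius `r / c` inside the domain.
  refine ⟨min (δ * c ^ 2 / K) (c * ρ / 4), by positivity, fun a ha r hr0 hr => ?_⟩
  have hr1 : K * (r / c) / c ≤ δ := by
    have : r ≤ δ * c ^ 2 / K := hr.trans (min_le_left _ _)
    rw [le_div_iff₀ hK] at this
    rw [div_le_iff₀ hc, ← mul_div_assoc, div_le_iff₀ hc]
    nlinarith
  have hr2 : r / c < ρ / 2 := by
    have : r ≤ c * ρ / 4 := hr.trans (min_le_right _ _)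
    rw [div_lt_iff₀ hc]; nlinarith [mul_pos hc hρ]
  have ha' := h.mem_ball_of_half ha
  obtain ⟨Λ, hΛ⟩ := exists_linearEquiv_norm_eq (D a) (h.injective ha')
  -- Linear coordinates in which `D a` is isometric, so `ψ ∘ g` shrinks distances by a factor of at
  -- most `1 + δ`.
  let g : EuclideanSpace ℝ (Fin m) → EuclideanSpace ℝ (Fin m) := fun v => a + Λ.symm v
  have hgn : ∀ v v', ‖v - v'‖ = ‖D a (g v - g v')‖ := fun v v' => by
    rw [← hΛ]; simp [g]
  have hga : ∀ v, ‖v‖ = ‖D a (g v - a)‖ := fun v => by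
    rw [← hΛ]; simp [g]
  have hgσ : ∀ v ∈ Metric.closedBall (0 : EuclideanSpace ℝ (Fin m)) r,
      g v ∈ Metric.closedBall a (r / c) := fun v hv => by
    rw [mem_closedBall_iff_norm, le_div_iff₀ hc, mul_comm]
    refine (h.le_norm_apply ha' _).trans ?_
    rw [← hga]; simpa using hv
  have hsub := closedBall_subset ha hr2
  have key : ∀ b ∈ Metric.closedBall a (r / c), ∀ b' ∈ Metric.closedBall a (r / c),
      ‖ψ b - ψ b' - D a (b - b')‖ ≤ K * (r / c) * ‖b - b'‖ := fun b hb b' hb' =>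
    h.norm_sub_sub_le (convex_closedBall a (r / c)) hsub ha' hb hb'
      (fun y hy => mem_closedBall_iff_norm.1 hy)
  have haσ : a ∈ Metric.closedBall a (r / c) := Metric.mem_closedBall_self (by positivity)
  have h1 := euclideanHausdorffMeasure_le_of_antilipschitzOn m (f := ψ ∘ g)
    (s := Metric.closedBall (0 : EuclideanSpace ℝ (Fin m)) r) (K := (1 + δ).toNNReal) (by
      intro v hv v' hv'
      have e1 := key _ (hgσ v hv) _ (hgσ v' hv')
      have e2 := h.antilip _ (hsub (hgσ v hv)) _ (hsub (hgσ v' hv'))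
      have e3 : ‖v - v'‖ ≤ (1 + δ) * ‖ψ (g v) - ψ (g v')‖ := by
        rw [hgn]
        have := norm_le_norm_add_norm_sub (ψ (g v) - ψ (g v')) (D a (g v - g v'))
        have e4 : K * (r / c) * ‖g v - g v'‖ ≤ δ * ‖ψ (g v) - ψ (g v')‖ := by
          calc K * (r / c) * ‖g v - g v'‖ = K * (r / c) / c * (c * ‖g v - g v'‖) := by
                field_simp
            _ ≤ δ * ‖ψ (g v) - ψ (g v')‖ := by gcongr
        linarith
      rw [edist_dist, edist_dist, dist_eq_norm, dist_eq_norm]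
      change _ ≤ ENNReal.ofReal (1 + δ) * _
      rw [← ENNReal.ofReal_mul (by positivity)]
      exact ENNReal.ofReal_le_ofReal e3)
  rw [EuclideanSpace.euclideanHausdorffMeasure_eq_volume] at h1
  refine h1.trans ?_
  change ENNReal.ofReal (1 + δ) ^ m * _ ≤ _
  gcongr
  rintro _ ⟨v, hv, rfl⟩
  refine ⟨⟨g v, hsub (hgσ v hv), rfl⟩, ?_⟩
  have e1 := key _ (hgσ v hv) _ haσ
  have e2 := h.le_norm_apply ha' (g v - a)
  rw [← hga] at e2
  have hv' : ‖v‖ ≤ r := by simpa using hv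
  have e4 : K * (r / c) * ‖g v - a‖ ≤ δ * r := by
    calc K * (r / c) * ‖g v - a‖ = K * (r / c) / c * (c * ‖g v - a‖) := by field_simp
      _ ≤ δ * r := by gcongr; exact e2.trans hv'
  have := norm_le_norm_add_norm_sub' (ψ (g v) - ψ a) (D a (g v - a))
  rw [← hga] at this
  simp only [Function.comp_apply]
  linarith

/-- The volume of a Euclidean annulus in the image is bounded by that of a slightly thicker
annulus in the tangent space. -/
theorem euclideanHausdorffMeasure_annulus_le (h : LocalParam ψ D a₀ ρ c K) :
    ∃ r₁ > 0, ∀ a ∈ Metric.ball a₀ (ρ / 2), ∀ r s, 0 ≤ r → r ≤ r₁ →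
      Measure.euclideanHausdorffMeasure m
          {y ∈ ψ '' Metric.ball a₀ ρ | s ≤ ‖y - ψ a‖ ∧ ‖y - ψ a‖ ≤ r} ≤
        2 ^ m * volume {v : EuclideanSpace ℝ (Fin m) |
          s - (K / c ^ 2) ^ 2 * r ^ 3 ≤ ‖v‖ ∧ ‖v‖ ≤ r} := by
  have hc := h.c_pos
  have hK := h.K_pos
  have hρ := h.rho_pos
  refine ⟨min (c ^ 2 / (2 * K)) (c * ρ / 4), by positivity, fun a ha r s hr0 hr => ?_⟩
  have hr1 : K * (r / c) / c ≤ 1 / 2 := by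
    have : r ≤ c ^ 2 / (2 * K) := hr.trans (min_le_left _ _)
    rw [le_div_iff₀ (by positivity)] at this
    rw [div_le_iff₀ hc, ← mul_div_assoc, div_le_iff₀ hc]
    nlinarith
  have hr2 : r / c < ρ / 2 := by
    have : r ≤ c * ρ / 4 := hr.trans (min_le_right _ _)
    rw [div_lt_iff₀ hc]; nlinarith [mul_pos hc hρ]
  have ha' := h.mem_ball_of_half ha
  obtain ⟨P, hP⟩ := exists_projection_range (D a) (h.injective ha')
  have hsub := closedBall_subset ha hr2
  have key : ∀ b ∈ Metric.closedBall a (r / c), ∀ b' ∈ Metric.closedBall a (r / c),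
      ‖ψ b - ψ b' - D a (b - b')‖ ≤ K * (r / c) * ‖b - b'‖ := fun b hb b' hb' =>
    h.norm_sub_sub_le (convex_closedBall a (r / c)) hsub ha' hb hb'
      (fun y hy => mem_closedBall_iff_norm.1 hy)
  have hbσ : ∀ b ∈ Metric.ball a₀ ρ, ‖ψ b - ψ a‖ ≤ r → b ∈ Metric.closedBall a (r / c) := by
    intro b hb hbr
    rw [mem_closedBall_iff_norm, le_div_iff₀ hc, mul_comm]
    exact (h.antilip b hb a ha').trans hbr
  -- Project to the tangent space. With relative error `1/2`, Pythagoras leaves distances at least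
  -- half as large; the crude factor 2 suffices, since only the order of the shell volume matters.
  have h1 := euclideanHausdorffMeasure_le_of_antilipschitzOn m (f := fun y => P (y - ψ a))
    (s := {y ∈ ψ '' Metric.ball a₀ ρ | s ≤ ‖y - ψ a‖ ∧ ‖y - ψ a‖ ≤ r}) (K := 2) (by
      rintro _ ⟨⟨b, hb, rfl⟩, -, hbr⟩ _ ⟨⟨b', hb', rfl⟩, -, hbr'⟩
      have e1 := key _ (hbσ b hb hbr) _ (hbσ b' hb' hbr')
      have e2 := h.antilip b hb b' hb'
      have e4 : K * (r / c) * ‖b - b'‖ ≤ 1 / 2 * ‖ψ b - ψ b'‖ := by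
        calc K * (r / c) * ‖b - b'‖ = K * (r / c) / c * (c * ‖b - b'‖) := by field_simp
          _ ≤ 1 / 2 * ‖ψ b - ψ b'‖ := by gcongr
      have e5 := (hP (ψ b - ψ b') (b - b')).1
      have e6 : ‖ψ b - ψ b'‖ ≤ 2 * ‖P (ψ b - ψ b')‖ := by
        have : ‖ψ b - ψ b' - D a (b - b')‖ ^ 2 ≤ (1 / 2 * ‖ψ b - ψ b'‖) ^ 2 := by
          gcongr; exact e1.trans e4
        refine (sq_le_sq₀ (norm_nonneg _) (by positivity)).1 ?_
        nlinarith [sq_nonneg ‖P (ψ b - ψ b')‖]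
      rw [edist_dist, edist_dist, dist_eq_norm, dist_eq_norm, ← map_sub, sub_sub_sub_cancel_right]
      rw [show ((2 : NNReal) : ℝ≥0∞) = ENNReal.ofReal 2 by simp,
        ← ENNReal.ofReal_mul (by positivity)]
      exact ENNReal.ofReal_le_ofReal e6)
  rw [EuclideanSpace.euclideanHausdorffMeasure_eq_volume] at h1
  refine h1.trans ?_
  rw [show ((2 : NNReal) : ℝ≥0∞) = 2 by simp]
  gcongr
  rintro _ ⟨_, ⟨⟨b, hb, rfl⟩, hbs, hbr⟩, rfl⟩
  refine ⟨?_, (hP _ 0).2.trans hbr⟩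
  set u := ‖ψ b - ψ a‖ with hu
  have hu0 : 0 ≤ u := norm_nonneg _
  have e1 := h.norm_sub_sub_le_sq ha' hb (left_mem_segment ℝ a b)
  have e2 : c * ‖b - a‖ ≤ u := h.antilip b hb a ha'
  have e3 : ‖ψ b - ψ a - D a (b - a)‖ ≤ K / c ^ 2 * u ^ 2 := by
    refine e1.trans ?_
    calc K * ‖b - a‖ * ‖b - a‖ = K / c ^ 2 * (c * ‖b - a‖) ^ 2 := by field_simp
      _ ≤ _ := by gcongr
  have e4 := (hP (ψ b - ψ a) (b - a)).1
  rw [← hu] at e4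
  have e5 : u ^ 2 ≤ ‖P (ψ b - ψ a)‖ ^ 2 + (K / c ^ 2 * u ^ 2) ^ 2 := by
    refine e4.trans ?_; gcongr
  -- The normal component is quadratic in `u`, so by Pythagoras the projection shortens by only a
  -- cubic amount.
  have e6 : u - (K / c ^ 2) ^ 2 * u ^ 3 ≤ ‖P (ψ b - ψ a)‖ := by
    by_contra hlt
    push Not at hlt
    have hp : 0 ≤ ‖P (ψ b - ψ a)‖ := norm_nonneg _
    set q := (K / c ^ 2) ^ 2 * u ^ 3 with hq
    have hq0 : 0 ≤ q := by positivity
    have : (K / c ^ 2 * u ^ 2) ^ 2 = q * u := by rw [hq]; ring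
    rw [this] at e5
    have : ‖P (ψ b - ψ a)‖ ^ 2 < (u - q) ^ 2 := by gcongr
    nlinarith
  have e7 : (K / c ^ 2) ^ 2 * u ^ 3 ≤ (K / c ^ 2) ^ 2 * r ^ 3 := by gcongr
  linarith

end LocalParam

/-- Mean value estimate for powers; the extra factor `r` avoids the exponent `m - 1`. -/
theorem mul_pow_sub_pow_le {r s : ℝ} (hs : 0 ≤ s) (hsr : s ≤ r) (m : ℕ) :
    r * (r ^ m - s ^ m) ≤ m * r ^ m * (r - s) := by
  induction m with
  | zero => simp
  | succ n ih =>
    have h1 : s ^ n ≤ r ^ n := by gcongr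
    have h2 := mul_le_mul_of_nonneg_left ih (hs.trans hsr)
    have h3 : 0 ≤ r * ((r - s) * (r ^ n - s ^ n)) :=
      mul_nonneg (hs.trans hsr) (mul_nonneg (sub_nonneg.2 hsr) (sub_nonneg.2 h1))
    push_cast
    rw [pow_succ, pow_succ]
    nlinarith

theorem unitBallVol_pos (m : ℕ) : 0 < unitBallVol m :=
  ENNReal.toReal_pos (Metric.measure_ball_pos _ _ one_pos).ne' Metric.isBounded_ball.measure_lt_top.ne

theorem volume_real_closedBall {m : ℕ} {r : ℝ} (hr : 0 ≤ r) :
    volume.real (Metric.closedBall (0 : EuclideanSpace ℝ (Fin m)) r) = unitBallVol m * r ^ m := by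
  rw [Measure.addHaar_real_closedBall _ _ hr, finrank_euclideanSpace_fin, mul_comm]
  rfl

theorem volume_annulus_le {m : ℕ} (hm : m ≠ 0) {C : ℝ} (hC : 0 ≤ C) {r : ℝ} (hr : 0 < r) :
    volume {v : EuclideanSpace ℝ (Fin m) | r - C * r ^ 3 ≤ ‖v‖ ∧ ‖v‖ ≤ r} ≤
      ENNReal.ofReal (unitBallVol m * (m * C) * r ^ (m + 2)) := by
  -- The inner radius may be negative, hence the truncation.
  set s := max (r - C * r ^ 3) 0 with hs
  have hs0 : 0 ≤ s := le_max_right _ _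
  have hC3 : 0 ≤ C * r ^ 3 := by positivity
  have hsr : s ≤ r := max_le (by linarith) hr.le
  have hne : Nonempty (Fin m) := ⟨⟨0, Nat.pos_of_ne_zero hm⟩⟩
  have hsub : {v : EuclideanSpace ℝ (Fin m) | r - C * r ^ 3 ≤ ‖v‖ ∧ ‖v‖ ≤ r} ⊆
      Metric.closedBall 0 r \ Metric.ball 0 s := by
    rintro v ⟨h1, h2⟩
    refine ⟨by simpa using h2, ?_⟩
    simpa [hs] using h1
  refine (measure_mono hsub).trans ?_
  have hfin : volume (Metric.closedBall (0 : EuclideanSpace ℝ (Fin m)) r \ Metric.ball 0 s) ≠ ⊤ :=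
    ((measure_mono sdiff_subset).trans_lt Metric.isBounded_closedBall.measure_lt_top).ne
  rw [← ENNReal.ofReal_toReal hfin]
  refine ENNReal.ofReal_le_ofReal ?_
  change volume.real _ ≤ _
  rw [measureReal_sdiff (Metric.ball_subset_closedBall.trans (Metric.closedBall_subset_closedBall hsr))
    Metric.isOpen_ball.measurableSet Metric.isBounded_closedBall.measure_lt_top.ne, volume_real_closedBall hr.le]
  have h0 : volume.real (Metric.ball (0 : EuclideanSpace ℝ (Fin m)) s) = s ^ m * unitBallVol m := by
    rw [measureReal_def, Measure.addHaar_ball _ _ hs0, finrank_euclideanSpace_fin,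
      ENNReal.toReal_mul, ENNReal.toReal_ofReal (by positivity)]
    rfl
  rw [h0]
  have h1 := mul_pow_sub_pow_le hs0 hsr m
  have h2 : r - s ≤ C * r ^ 3 := by linarith [le_max_left (r - C * r ^ 3) 0]
  have h3 : r ^ m - s ^ m ≤ m * C * r ^ (m + 2) := by
    refine le_of_mul_le_mul_left (h1.trans ?_) hr
    calc m * r ^ m * (r - s) ≤ m * r ^ m * (C * r ^ 3) := by gcongr
      _ = r * (m * C * r ^ (m + 2)) := by ring
  nlinarith [mul_le_mul_of_nonneg_left h3 (unitBallVol_pos m).le]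

section LocalParametrization

variable {m d : ℕ} {M : Type*} [TopologicalSpace M] [ChartedSpace (EuclideanSpace ℝ (Fin m)) M]
  {ι : M → EuclideanSpace ℝ (Fin d)}

/-- In immersion charts `ι` is `u ↦ (u, 0)` up to a linear equivalence, so `ι ∘ φ.symm` has a smooth
left inverse `θ`, whose local Lipschitz constant yields `antilip`. The last clause uses that `ι` is
a topological embedding: Euclidean-close points lie in the same chart. -/
theorem exists_localParam
    (hι : Manifold.IsSmoothEmbedding (𝓡 m) 𝓘(ℝ, EuclideanSpace ℝ (Fin d)) ∞ ι) (x₀ : M) :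
    ∃ (g : EuclideanSpace ℝ (Fin m) → M)
      (D : EuclideanSpace ℝ (Fin m) → EuclideanSpace ℝ (Fin m) →L[ℝ] EuclideanSpace ℝ (Fin d))
      (a₀ : EuclideanSpace ℝ (Fin m)) (ρ c K : ℝ), LocalParam (ι ∘ g) D a₀ ρ c K ∧
      ContMDiffOn (𝓡 m) (𝓡 m) 1 g (Metric.ball a₀ ρ) ∧
      ∃ r₀ > 0, ∀ y, dist (ι y) (ι x₀) < r₀ → ∃ a ∈ Metric.ball a₀ (ρ / 2), g a = y := by
  have h := hι.isImmersion.isImmersionAt x₀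
  set φ := h.domChart with hφ
  set κ := h.codChart with hκ
  have hx₀ : x₀ ∈ φ.source := h.mem_domChart_source
  have hgφ : ContMDiffOn (𝓡 m) (𝓡 m) ∞ φ.symm φ.target :=
    contMDiffOn_symm_of_mem_maximalAtlas h.domChart_mem_maximalAtlas
  have hψ : ContDiffOn ℝ ∞ (ι ∘ φ.symm) φ.target :=
    contMDiffOn_iff_contDiffOn.1 (hι.contMDiff.comp_contMDiffOn hgφ)
  have hκs : ContDiffOn ℝ ∞ κ κ.source :=
    contMDiffOn_iff_contDiffOn.1 (contMDiffOn_of_mem_maximalAtlas h.codChart_mem_maximalAtlas)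
  let θ : EuclideanSpace ℝ (Fin d) → EuclideanSpace ℝ (Fin m) := fun z => (h.equiv.symm (κ z)).1
  have hθ : ContDiffOn ℝ ∞ θ κ.source :=
    contDiff_fst.comp_contDiffOn (h.equiv.symm.contDiff.comp_contDiffOn hκs)
  have hθψ : ∀ u ∈ φ.target, θ ((ι ∘ φ.symm) u) = u := by
    intro u hu
    have hu' : u ∈ (h.domChart.extend (𝓡 m)).target := by
      simpa only [OpenPartialHomeomorph.extend_target, modelWithCornersSelf_coe_symm,
        modelWithCornersSelf_coe, preimage_id, range_id, inter_univ] using hu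
    have := h.writtenInCharts hu'
    simp only [Function.comp_apply, OpenPartialHomeomorph.extend_coe,
      OpenPartialHomeomorph.extend_coe_symm, modelWithCornersSelf_coe,
      modelWithCornersSelf_coe_symm, id] at this
    simp only [θ, Function.comp_apply]
    rw [hκ, hφ, this]
    simp
  set a₀ := φ x₀ with ha₀
  have ha₀t : a₀ ∈ φ.target := φ.map_source hx₀
  have ht : φ.target ∈ nhds a₀ := φ.open_target.mem_nhds ha₀t
  have hψa : ContDiffAt ℝ ∞ (ι ∘ φ.symm) a₀ := hψ.contDiffAt ht
  have hιx : (ι ∘ φ.symm) a₀ = ι x₀ := by simp [ha₀, φ.left_inv hx₀]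
  obtain ⟨K, t, htn, hK⟩ : ∃ K : NNReal, ∃ t ∈ nhds a₀, LipschitzOnWith K
      (fderiv ℝ (ι ∘ φ.symm)) t :=
    (hψa.fderiv_right (m := 1) (by norm_cast)).exists_lipschitzOnWith
  obtain ⟨K', t', htn', hK'⟩ : ∃ K : NNReal, ∃ t ∈ nhds (ι x₀), LipschitzOnWith K θ t := by
    have := hθ.contDiffAt (κ.open_source.mem_nhds h.mem_codChart_source)
    exact (this.of_le (by simp)).exists_lipschitzOnWith
  have hpre : (ι ∘ φ.symm) ⁻¹' t' ∈ nhds a₀ := hψa.continuousAt (by rwa [hιx])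
  obtain ⟨ρ, hρ, hsub⟩ := Metric.mem_nhds_iff.1 (Filter.inter_mem (Filter.inter_mem ht htn) hpre)
  refine ⟨φ.symm, fderiv ℝ (ι ∘ φ.symm), a₀, ρ, 1 / (K' + 1), K + 1,
    ⟨hρ, by positivity, by positivity, fun a ha => ?_, fun a ha b hb => ?_, fun a ha b hb => ?_⟩,
    (hgφ.of_le (by norm_cast)).mono fun a ha => (hsub ha).1.1, ?_⟩
  · exact ((hψ.contDiffAt (φ.open_target.mem_nhds (hsub ha).1.1)).differentiableAt
      (by simp)).hasFDerivAt
  · have := hK.dist_le_mul a (hsub ha).1.2 b (hsub hb).1.2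
    rw [dist_eq_norm, dist_eq_norm] at this
    nlinarith [norm_nonneg (a - b)]
  · have := hK'.dist_le_mul _ (hsub ha).2 _ (hsub hb).2
    rw [hθψ a (hsub ha).1.1, hθψ b (hsub hb).1.1, dist_eq_norm, dist_eq_norm] at this
    rw [one_div, inv_mul_le_iff₀ (by positivity)]
    nlinarith [norm_nonneg ((ι ∘ φ.symm) a - (ι ∘ φ.symm) b)]
  · have hn : φ.source ∩ φ ⁻¹' Metric.ball a₀ (ρ / 2) ∈ nhds x₀ :=
      (φ.isOpen_inter_preimage Metric.isOpen_ball).mem_nhds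
        ⟨hx₀, Metric.mem_ball_self (by positivity)⟩
    rw [hι.isEmbedding.nhds_eq_comap, Filter.mem_comap] at hn
    obtain ⟨V, hV, hVs⟩ := hn
    obtain ⟨r₀, hr₀, hr₀s⟩ := Metric.mem_nhds_iff.1 hV
    refine ⟨r₀, hr₀, fun y hy => ?_⟩
    have hy' := hVs (hr₀s hy : ι y ∈ V)
    exact ⟨φ y, hy'.2, φ.left_inv hy'.1⟩

end LocalParametrization

/-! ### The geodesic distance as a Riemannian distance. -/

section GeodesicDistance

variable {m d : ℕ} {M : Type*} [TopologicalSpace M] [ChartedSpace (EuclideanSpace ℝ (Fin m)) M]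

/-- The geodesic distance with values in `[0, ∞]`. -/
noncomputable def geodEDist (ι : M → EuclideanSpace ℝ (Fin d)) (x y : M) : ℝ≥0∞ :=
  ⨅ (γ : ℝ → M) (_ : ContMDiffOn 𝓘(ℝ, ℝ) (𝓡 m) 1 γ (Icc 0 1) ∧ γ 0 = x ∧ γ 1 = y),
    ∫⁻ t in Icc (0 : ℝ) 1, ‖deriv (ι ∘ γ) t‖ₑ

theorem geodDist_eq_toReal (ι : M → EuclideanSpace ℝ (Fin d)) (x y : M) :
    geodDist (m := m) ι x y = (geodEDist (m := m) ι x y).toReal := rfl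

/-- The norm on tangent vectors of the metric induced by `ι`. -/
@[reducible]
noncomputable def inducedENorm (ι : M → EuclideanSpace ℝ (Fin d)) (x : M) :
    ENorm (TangentSpace (𝓡 m) x) :=
  ⟨fun v => enorm (E := EuclideanSpace ℝ (Fin d))
    (mfderiv (𝓡 m) 𝓘(ℝ, EuclideanSpace ℝ (Fin d)) ι x v)⟩

theorem inducedENorm_enormSMulClass (ι : M → EuclideanSpace ℝ (Fin d)) (x : M) :
    letI := inducedENorm (m := m) ι
    ENormSMulClass ℝ (TangentSpace (𝓡 m) x) := by
  let _ := inducedENorm (m := m) ι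
  refine ⟨fun r v => ?_⟩
  have h := map_smul (mfderiv (𝓡 m) 𝓘(ℝ, EuclideanSpace ℝ (Fin d)) ι x) r v
  exact (congrArg (enorm (E := EuclideanSpace ℝ (Fin d))) h).trans
    (enorm_smul (β := EuclideanSpace ℝ (Fin d)) r _)

variable {ι : M → EuclideanSpace ℝ (Fin d)}

theorem lintegral_enorm_deriv_eq_pathELength
    (hι : ContMDiff (𝓡 m) 𝓘(ℝ, EuclideanSpace ℝ (Fin d)) ∞ ι) {γ : ℝ → M}
    (hγ : ContMDiffOn 𝓘(ℝ, ℝ) (𝓡 m) 1 γ (Icc 0 1)) :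
    letI := inducedENorm (m := m) ι
    ∫⁻ t in Icc (0 : ℝ) 1, ‖deriv (ι ∘ γ) t‖ₑ = Manifold.pathELength (𝓡 m) γ 0 1 := by
  let _ := inducedENorm (m := m) ι
  -- The endpoints are a null set and must be dropped: `γ` is `C^1` only within `[0,1]`, so `deriv`
  -- may be a default value there.
  rw [Manifold.pathELength_eq_lintegral_mfderiv_Ioo, ← restrict_Ioo_eq_restrict_Icc]
  refine setLIntegral_congr_fun measurableSet_Ioo fun t ht => ?_
  have h1 : MDifferentiableAt 𝓘(ℝ, ℝ) (𝓡 m) γ t :=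
    ((hγ t ⟨ht.1.le, ht.2.le⟩).contMDiffAt (Icc_mem_nhds ht.1 ht.2)).mdifferentiableAt (by simp)
  have h2 : MDifferentiableAt (𝓡 m) 𝓘(ℝ, EuclideanSpace ℝ (Fin d)) ι (γ t) :=
    (hι (γ t)).mdifferentiableAt (by simp)
  have h3 := mfderiv_comp t h2 h1
  rw [mfderiv_eq_fderiv] at h3
  change ‖deriv (ι ∘ γ) t‖ₑ = enorm (E := EuclideanSpace ℝ (Fin d))
    (mfderiv (𝓡 m) 𝓘(ℝ, EuclideanSpace ℝ (Fin d)) ι (γ t)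
      (mfderiv 𝓘(ℝ, ℝ) (𝓡 m) γ t (1 : ℝ)))
  rw [← fderiv_apply_one_eq_deriv]
  have h4 := congrArg (fun L : ℝ →L[ℝ] EuclideanSpace ℝ (Fin d) => L 1) h3
  exact congrArg _ h4

/-- Gives symmetry and the triangle inequality without a separate treatment of reversed and
concatenated curves. -/
theorem geodEDist_eq_riemannianEDist
    (hι : ContMDiff (𝓡 m) 𝓘(ℝ, EuclideanSpace ℝ (Fin d)) ∞ ι) (x y : M) :
    letI := inducedENorm (m := m) ι
    geodEDist (m := m) ι x y = Manifold.riemannianEDist (𝓡 m) x y := by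
  let _ := inducedENorm (m := m) ι
  have := inducedENorm_enormSMulClass (m := m) ι
  refine le_antisymm (le_of_forall_gt fun r hr => ?_) (le_iInf₂ fun γ hγ => ?_)
  · obtain ⟨γ, h0, h1, hγ, hl⟩ := Manifold.exists_lt_of_riemannianEDist_lt hr
    rw [← lintegral_enorm_deriv_eq_pathELength hι hγ] at hl
    exact (iInf₂_le γ ⟨hγ, h0, h1⟩).trans_lt hl
  · rw [lintegral_enorm_deriv_eq_pathELength hι hγ.1]
    exact Manifold.riemannianEDist_le_pathELength hγ.1 hγ.2.1 hγ.2.2 zero_le_one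

theorem geodEDist_triangle
    (hι : ContMDiff (𝓡 m) 𝓘(ℝ, EuclideanSpace ℝ (Fin d)) ∞ ι) (x y z : M) :
    geodEDist (m := m) ι x z ≤ geodEDist (m := m) ι x y + geodEDist (m := m) ι y z := by
  let _ := inducedENorm (m := m) ι
  have := inducedENorm_enormSMulClass (m := m) ι
  simp only [geodEDist_eq_riemannianEDist hι]
  exact Manifold.riemannianEDist_triangle

theorem geodEDist_comm
    (hι : ContMDiff (𝓡 m) 𝓘(ℝ, EuclideanSpace ℝ (Fin d)) ∞ ι) (x y : M) :
    geodEDist (m := m) ι x y = geodEDist (m := m) ι y x := by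
  let _ := inducedENorm (m := m) ι
  have := inducedENorm_enormSMulClass (m := m) ι
  simp only [geodEDist_eq_riemannianEDist hι]
  exact Manifold.riemannianEDist_comm

theorem edist_le_geodEDist
    (hι : ContMDiff (𝓡 m) 𝓘(ℝ, EuclideanSpace ℝ (Fin d)) ∞ ι) (x y : M) :
    edist (ι x) (ι y) ≤ geodEDist (m := m) ι x y := by
  refine le_iInf₂ fun γ hγ => ?_
  have h1 : ContDiffOn ℝ 1 (ι ∘ γ) (Icc 0 1) :=
    contMDiffOn_iff_contDiffOn.1 ((hι.of_le (by simp)).comp_contMDiffOn hγ.1)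
  have h2 := enorm_sub_le_lintegral_derivWithin_Icc_of_contDiffOn_Icc h1 zero_le_one
  simp only [Function.comp_apply, hγ.2.1, hγ.2.2] at h2
  rw [edist_comm, edist_eq_enorm_sub]
  refine h2.trans_eq ?_
  rw [← restrict_Ioo_eq_restrict_Icc]
  refine setLIntegral_congr_fun measurableSet_Ioo fun t ht => ?_
  rw [derivWithin_of_mem_nhds (Icc_mem_nhds ht.1 ht.2)]

/-- The competing curve is the image of the straight segment from `a` to `b`. -/
theorem geodEDist_le_of_localParam {g : EuclideanSpace ℝ (Fin m) → M}
    {D : EuclideanSpace ℝ (Fin m) → EuclideanSpace ℝ (Fin m) →L[ℝ] EuclideanSpace ℝ (Fin d)}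
    {a₀ : EuclideanSpace ℝ (Fin m)} {ρ c K : ℝ} (h : LocalParam (ι ∘ g) D a₀ ρ c K)
    (hg : ContMDiffOn (𝓡 m) (𝓡 m) 1 g (Metric.ball a₀ ρ)) {a b : EuclideanSpace ℝ (Fin m)}
    (ha : a ∈ Metric.ball a₀ ρ) (hb : b ∈ Metric.ball a₀ ρ) :
    geodEDist (m := m) ι (g a) (g b) ≤ ENNReal.ofReal (dist (ι (g a)) (ι (g b))
      + K ^ 2 / (2 * c ^ 4) * dist (ι (g a)) (ι (g b)) ^ 3) := by
  have hseg : ∀ t ∈ Icc (0 : ℝ) 1, a + t • (b - a) ∈ Metric.ball a₀ ρ := fun t ht =>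
    (convex_ball a₀ ρ).segment_subset ha hb (segment_eq_image' ℝ a b ▸ ⟨t, ht, rfl⟩)
  have h1 := h.lintegral_enorm_le ha hb
  rw [dist_comm, dist_eq_norm]
  refine le_trans ?_ h1
  refine (iInf₂_le (fun t : ℝ => g (a + t • (b - a))) ⟨?_, by simp, by simp⟩).trans_eq ?_
  · refine setLIntegral_congr_fun measurableSet_Icc fun t ht => ?_
    have h2 : HasDerivAt (fun t : ℝ => a + t • (b - a)) (b - a) t := by
      simpa using ((hasDerivAt_id t).smul_const (b - a)).const_add a
    have h3 := (h.hasFDerivAt _ (hseg t ht)).comp_hasDerivAt t h2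
    exact congrArg _ h3.deriv
  · have h0 : ContMDiffOn 𝓘(ℝ, ℝ) (𝓡 m) 1 (fun t : ℝ => a + t • (b - a)) (Icc 0 1) := by
      rw [contMDiffOn_iff_contDiffOn]
      fun_prop
    exact hg.comp h0 hseg

end GeodesicDistance

/-! ### Uniform distance bounds by compactness. -/

theorem exists_uniform_of_local {X : Type*} [TopologicalSpace X] [CompactSpace X]
    {Q : X → ℝ → ℝ → Prop}
    (mono : ∀ x r r' C C', r' ≤ r → C ≤ C' → Q x r C → Q x r' C')
    (loc : ∀ x₀, ∃ r > 0, ∃ C, ∀ᶠ x in nhds x₀, Q x r C) :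
    ∃ r > 0, ∃ C > 0, ∀ x, Q x r C := by
  have h : ∃ r > 0, ∃ C > 0, ∀ x ∈ (univ : Set X), Q x r C := by
    refine isCompact_univ.induction_on (p := fun s => ∃ r > 0, ∃ C > 0, ∀ x ∈ s, Q x r C)
      ⟨1, one_pos, 1, one_pos, by simp⟩ ?_ ?_ ?_
    · rintro s t hst ⟨r, hr, C, hC, h⟩
      exact ⟨r, hr, C, hC, fun x hx => h x (hst hx)⟩
    · rintro s t ⟨r, hr, C, hC, h⟩ ⟨r', hr', C', hC', h'⟩
      refine ⟨min r r', lt_min hr hr', max C C', lt_max_of_lt_left hC, ?_⟩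
      rintro x (hx | hx)
      · exact mono x _ _ _ _ (min_le_left _ _) (le_max_left _ _) (h x hx)
      · exact mono x _ _ _ _ (min_le_right _ _) (le_max_right _ _) (h' x hx)
    · intro x _
      obtain ⟨r, hr, C, h⟩ := loc x
      exact ⟨_, mem_nhdsWithin_of_mem_nhds h, r, hr, max C 1, lt_max_of_lt_right one_pos,
        fun y hy => mono y _ _ _ _ le_rfl (le_max_left _ _) hy⟩
  obtain ⟨r, hr, C, hC, h⟩ := h
  exact ⟨r, hr, C, hC, fun x => h x (mem_univ x)⟩

variable {m d : ℕ} {M : Type*} [TopologicalSpace M] [ChartedSpace (EuclideanSpace ℝ (Fin m)) M]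
  {ι : M → EuclideanSpace ℝ (Fin d)} [CompactSpace M]

section Distance

theorem exists_geodEDist_le_add_cube
    (hι : Manifold.IsSmoothEmbedding (𝓡 m) 𝓘(ℝ, EuclideanSpace ℝ (Fin d)) ∞ ι) :
    ∃ r > 0, ∃ C > 0, ∀ x y, dist (ι x) (ι y) < r →
      geodEDist (m := m) ι x y
        ≤ ENNReal.ofReal (dist (ι x) (ι y) + C * dist (ι x) (ι y) ^ 3) := by
  refine exists_uniform_of_local (fun x r r' C C' hr hC h y hy => ?_) fun x₀ => ?_
  · refine (h y (hy.trans_le hr)).trans (ENNReal.ofReal_le_ofReal ?_)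
    gcongr
  · obtain ⟨g, D, a₀, ρ, c, K, h, hg, r₀, hr₀, hsurj⟩ := exists_localParam hι x₀
    refine ⟨r₀ / 2, by positivity, K ^ 2 / (2 * c ^ 4), ?_⟩
    filter_upwards [hι.isEmbedding.continuous.continuousAt.preimage_mem_nhds
      (Metric.ball_mem_nhds (ι x₀) (half_pos hr₀))] with x hx y hxy
    have hx : dist (ι x) (ι x₀) < r₀ / 2 := hx
    obtain ⟨a, ha, rfl⟩ := hsurj x (by linarith)
    obtain ⟨b, hb, rfl⟩ := hsurj y (by
      have := dist_triangle_left (ι y) (ι x₀) (ι (g a))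
      linarith)
    exact geodEDist_le_of_localParam h hg (h.mem_ball_of_half ha) (h.mem_ball_of_half hb)

/-- Points at finite distance from `x₀` form a clopen set, hence all of `M`; compactness then bounds
the distance. Finiteness matters because `toReal` would send `∞` to `0`. -/
theorem exists_geodEDist_le [ConnectedSpace M]
    (hι : Manifold.IsSmoothEmbedding (𝓡 m) 𝓘(ℝ, EuclideanSpace ℝ (Fin d)) ∞ ι) :
    ∃ D > 0, ∀ x y, geodEDist (m := m) ι x y ≤ ENNReal.ofReal D := by
  obtain ⟨r, hr, C, hC, h⟩ := exists_geodEDist_le_add_cube hι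
  have hnear : ∀ x y, dist (ι x) (ι y) < r →
      geodEDist (m := m) ι x y ≤ ENNReal.ofReal (r + C * r ^ 3) := fun x y hxy =>
    (h x y hxy).trans (ENNReal.ofReal_le_ofReal (by gcongr))
  have hnhds : ∀ x, ∀ᶠ y in nhds x, dist (ι x) (ι y) < r := fun x => by
    filter_upwards [hι.isEmbedding.continuous.continuousAt.preimage_mem_nhds
      (Metric.ball_mem_nhds (ι x) hr)] with y hy
    rw [dist_comm]; exact hy
  obtain ⟨x₀⟩ : Nonempty M := inferInstance
  have hclopen : IsClopen {x | geodEDist (m := m) ι x₀ x < ⊤} := by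
    constructor
    · rw [← isOpen_compl_iff, isOpen_iff_mem_nhds]
      intro x hx
      filter_upwards [hnhds x] with y hy hlt
      refine hx ((geodEDist_triangle hι.contMDiff x₀ y x).trans_lt (ENNReal.add_lt_top.2 ⟨hlt, ?_⟩))
      rw [geodEDist_comm hι.contMDiff]
      exact (hnear x y hy).trans_lt ENNReal.ofReal_lt_top
    · rw [isOpen_iff_mem_nhds]
      intro x hx
      filter_upwards [hnhds x] with y hy
      exact (geodEDist_triangle hι.contMDiff x₀ x y).trans_lt
        (ENNReal.add_lt_top.2 ⟨hx, (hnear x y hy).trans_lt ENNReal.ofReal_lt_top⟩)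
  have hall : ∀ x, geodEDist (m := m) ι x₀ x < ⊤ := by
    have h1 : {x | geodEDist (m := m) ι x₀ x < ⊤} = univ := by
      refine hclopen.eq_univ ⟨x₀, ?_⟩
      exact (hnear x₀ x₀ (by simpa using hr)).trans_lt ENNReal.ofReal_lt_top
    exact eq_univ_iff_forall.1 h1
  obtain ⟨r', -, D, hD, hb⟩ := exists_uniform_of_local
    (Q := fun x _ D => geodEDist (m := m) ι x₀ x ≤ ENNReal.ofReal D)
    (fun x _ _ C C' _ hC h => h.trans (ENNReal.ofReal_le_ofReal hC)) (fun x => by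
      refine ⟨1, one_pos, (geodEDist (m := m) ι x₀ x).toReal + (r + C * r ^ 3), ?_⟩
      filter_upwards [hnhds x] with y hy
      refine (geodEDist_triangle hι.contMDiff x₀ x y).trans ?_
      rw [ENNReal.ofReal_add ENNReal.toReal_nonneg (by positivity),
        ENNReal.ofReal_toReal (hall x).ne]
      gcongr
      exact hnear x y hy)
  refine ⟨D + D, by positivity, fun x y => (geodEDist_triangle hι.contMDiff x x₀ y).trans ?_⟩
  rw [ENNReal.ofReal_add hD.le hD.le]
  gcongr
  · rw [geodEDist_comm hι.contMDiff]; exact hb x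
  · exact hb y

/-- The properties of the geodesic distance that are used below. -/
structure GeodesicBounds (m : ℕ) {d : ℕ} {M : Type*} [TopologicalSpace M]
    [ChartedSpace (EuclideanSpace ℝ (Fin m)) M] (ι : M → EuclideanSpace ℝ (Fin d))
    (r₁ C D : ℝ) : Prop where
  r₁_pos : 0 < r₁
  C_pos : 0 < C
  dist_le : ∀ x y, dist (ι x) (ι y) ≤ geodDist (m := m) ι x y
  le_add_cube : ∀ x y, dist (ι x) (ι y) < r₁ →
    geodDist (m := m) ι x y ≤ dist (ι x) (ι y) + C * dist (ι x) (ι y) ^ 3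
  le_diam : ∀ x y, geodDist (m := m) ι x y ≤ D
  continuous : ∀ x, Continuous (geodDist (m := m) ι x)

theorem exists_geodesicBounds [ConnectedSpace M]
    (hι : Manifold.IsSmoothEmbedding (𝓡 m) 𝓘(ℝ, EuclideanSpace ℝ (Fin d)) ∞ ι) :
    ∃ r₁ C D, GeodesicBounds m ι r₁ C D := by
  obtain ⟨r, hr, C, hC, h⟩ := exists_geodEDist_le_add_cube hι
  obtain ⟨D, hD, hdiam⟩ := exists_geodEDist_le hι
  have hfin : ∀ x y, geodEDist (m := m) ι x y ≠ ⊤ := fun x y =>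
    ((hdiam x y).trans_lt ENNReal.ofReal_lt_top).ne
  have hcube : ∀ x y, dist (ι x) (ι y) < r →
    geodDist (m := m) ι x y ≤ dist (ι x) (ι y) + C * dist (ι x) (ι y) ^ 3 := fun x y hxy =>
      ENNReal.toReal_le_of_le_ofReal (by positivity) (h x y hxy)
  have htri : ∀ x y z, geodDist (m := m) ι x z ≤ geodDist (m := m) ι x y
      + geodDist (m := m) ι y z := fun x y z => by
    simp only [geodDist_eq_toReal]
    rw [← ENNReal.toReal_add (hfin x y) (hfin y z)]
    exact ENNReal.toReal_mono (ENNReal.add_ne_top.2 ⟨hfin x y, hfin y z⟩)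
      (geodEDist_triangle hι.contMDiff x y z)
  have hcomm : ∀ x y, geodDist (m := m) ι x y = geodDist (m := m) ι y x := fun x y =>
    congrArg ENNReal.toReal (geodEDist_comm hι.contMDiff x y)
  refine ⟨r, C, D, hr, hC, fun x y => ?_, hcube, fun x y => ?_, fun x => ?_⟩
  · rw [geodDist_eq_toReal, ← ENNReal.ofReal_le_iff_le_toReal (hfin x y), ← edist_dist]
    exact edist_le_geodEDist hι.contMDiff x y
  · exact ENNReal.toReal_le_of_le_ofReal hD.le (hdiam x y)
  · refine continuous_iff_continuousAt.2 fun y => ?_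
    have hc : Filter.Tendsto (fun z => dist (ι y) (ι z) + C * dist (ι y) (ι z) ^ 3) (nhds y)
        (nhds 0) := by
      have : Continuous fun z => dist (ι y) (ι z) + C * dist (ι y) (ι z) ^ 3 := by
        have := hι.isEmbedding.continuous
        fun_prop
      simpa using this.tendsto y
    have hn : ∀ᶠ z in nhds y, dist (ι y) (ι z) < r := by
      filter_upwards [hι.isEmbedding.continuous.continuousAt.preimage_mem_nhds
        (Metric.ball_mem_nhds (ι y) hr)] with z hz
      rw [dist_comm]; exact hz
    rw [ContinuousAt, tendsto_iff_dist_tendsto_zero]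
    refine squeeze_zero' (Filter.Eventually.of_forall fun _ => dist_nonneg) ?_ hc
    filter_upwards [hn] with z hz
    have h1 := hcube y z hz
    have h2 := htri x y z
    have h3 := htri x z y
    rw [hcomm z y] at h3
    rw [Real.dist_eq, abs_le]
    constructor <;> linarith

end Distance

/-! ### Uniform volume bounds for small balls and shells. -/

section Volume

variable [MeasurableSpace M] [BorelSpace M]

theorem vol_apply
    (hι : Manifold.IsSmoothEmbedding (𝓡 m) 𝓘(ℝ, EuclideanSpace ℝ (Fin d)) ∞ ι) (s : Set M) :
    vol m ι s = Measure.euclideanHausdorffMeasure m (ι '' s) :=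
  (hι.isEmbedding.continuous.isClosedEmbedding
    hι.isEmbedding.injective).measurableEmbedding.comap_apply _ s

/-- Excludes ties: the sample points are almost surely distinct. -/
theorem vol_singleton (hm : m ≠ 0)
    (hι : Manifold.IsSmoothEmbedding (𝓡 m) 𝓘(ℝ, EuclideanSpace ℝ (Fin d)) ∞ ι) (x : M) :
    vol m ι {x} = 0 := by
  have := Measure.nullSingletonClass_hausdorff (EuclideanSpace ℝ (Fin d)) (d := (m : ℝ)) (by positivity)
  rw [vol_apply hι, image_singleton, Measure.euclideanHausdorffMeasure_def, Measure.smul_apply,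
    measure_singleton, smul_zero]

theorem exists_vol_annulus_le_volume
    (hι : Manifold.IsSmoothEmbedding (𝓡 m) 𝓘(ℝ, EuclideanSpace ℝ (Fin d)) ∞ ι) :
    ∃ r₁ > 0, ∃ C > 0, ∀ x : M, ∀ r s, 0 ≤ r → r ≤ r₁ →
      vol m ι {y | s ≤ dist (ι x) (ι y) ∧ dist (ι x) (ι y) ≤ r} ≤
        2 ^ m * volume {v : EuclideanSpace ℝ (Fin m) | s - C * r ^ 3 ≤ ‖v‖ ∧ ‖v‖ ≤ r} := by
  refine exists_uniform_of_local (fun x r r' C C' hr hC h r s hr0 hrr => ?_) fun x₀ => ?_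
  · refine (h r s hr0 (hrr.trans hr)).trans ?_
    gcongr
  · obtain ⟨g, D, a₀, ρ, c, K, h, hg, r₀, hr₀, hsurj⟩ := exists_localParam hι x₀
    obtain ⟨r₁, hr₁, hann⟩ := h.euclideanHausdorffMeasure_annulus_le
    refine ⟨min r₁ (r₀ / 4), by positivity, (K / c ^ 2) ^ 2, ?_⟩
    filter_upwards [hι.isEmbedding.continuous.continuousAt.preimage_mem_nhds
      (Metric.ball_mem_nhds (ι x₀) (half_pos hr₀))] with x hx r s hr0 hr
    have hx : dist (ι x) (ι x₀) < r₀ / 2 := hx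
    have hr4 := hr.trans (min_le_right _ _)
    obtain ⟨a, ha, rfl⟩ := hsurj x (by linarith)
    rw [vol_apply hι]
    refine le_trans (measure_mono ?_) (hann a ha r s hr0 (hr.trans (min_le_left _ _)))
    rintro _ ⟨y, ⟨hys, hyr⟩, rfl⟩
    obtain ⟨b, hb, rfl⟩ := hsurj y (by
      have := dist_triangle_left (ι y) (ι x₀) (ι (g a))
      linarith)
    rw [dist_comm, dist_eq_norm] at hys hyr
    exact ⟨⟨b, h.mem_ball_of_half hb, rfl⟩, hys, hyr⟩

/-- The thickness is cubic because the excess of geodesic distance over the chord is; the cubic loss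
in the projection only alters the constant. -/
theorem exists_vol_annulus_le (hm : m ≠ 0)
    (hι : Manifold.IsSmoothEmbedding (𝓡 m) 𝓘(ℝ, EuclideanSpace ℝ (Fin d)) ∞ ι)
    {L : ℝ} (hL : 0 < L) :
    ∃ r₁ > 0, ∃ C > 0, ∀ x : M, ∀ r, 0 < r → r ≤ r₁ →
      vol m ι {y | r - L * r ^ 3 ≤ dist (ι x) (ι y) ∧ dist (ι x) (ι y) ≤ r} ≤
        ENNReal.ofReal (C * r ^ (m + 2)) := by
  obtain ⟨r₁, hr₁, C, hC, h⟩ := exists_vol_annulus_le_volume hι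
  have hα := unitBallVol_pos m
  have hm' : (0 : ℝ) < m := by positivity
  refine ⟨r₁, hr₁, 2 ^ m * (unitBallVol m * (m * (L + C))), by positivity, fun x r hr0 hr => ?_⟩
  refine (h x r _ hr0.le hr).trans ?_
  have := volume_annulus_le hm (add_pos hL hC).le hr0
  rw [add_mul, ← sub_sub] at this
  refine (mul_le_mul_right this _).trans_eq ?_
  rw [show (2 : ℝ≥0∞) ^ m = ENNReal.ofReal (2 ^ m) by
    rw [ENNReal.ofReal_pow (by norm_num)]; simp, ← ENNReal.ofReal_mul (by positivity)]
  congr 1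
  ring

theorem exists_vol_ball_le
    (hι : Manifold.IsSmoothEmbedding (𝓡 m) 𝓘(ℝ, EuclideanSpace ℝ (Fin d)) ∞ ι) :
    ∃ r₁ > 0, ∃ C > 0, ∀ x : M, ∀ r, 0 < r → r ≤ r₁ →
      vol m ι {y | dist (ι x) (ι y) ≤ r} ≤ ENNReal.ofReal (C * r ^ m) := by
  obtain ⟨r₁, hr₁, C, hC, h⟩ := exists_vol_annulus_le_volume hι
  have hα := unitBallVol_pos m
  refine ⟨r₁, hr₁, 2 ^ m * unitBallVol m, by positivity, fun x r hr0 hr => ?_⟩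
  have h1 := h x r 0 hr0.le hr
  simp only [dist_nonneg, true_and] at h1
  refine (h1.trans (mul_le_mul_right (measure_mono (t := Metric.closedBall 0 r) ?_) _)).trans_eq ?_
  · rintro v ⟨-, hv⟩
    simpa using hv
  · rw [← ENNReal.ofReal_toReal (a := volume (Metric.closedBall _ r))
      Metric.isBounded_closedBall.measure_lt_top.ne]
    change 2 ^ m * ENNReal.ofReal (volume.real _) = _
    rw [volume_real_closedBall hr0.le, show (2 : ℝ≥0∞) ^ m = ENNReal.ofReal (2 ^ m) by
      rw [ENNReal.ofReal_pow (by norm_num)]; simp, ← ENNReal.ofReal_mul (by positivity)]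
    congr 1
    ring

/-- Unlike the upper bounds, this one is sharp up to `1 + δ`; `A` close to 2 depends on it. -/
theorem exists_le_vol_ball
    (hι : Manifold.IsSmoothEmbedding (𝓡 m) 𝓘(ℝ, EuclideanSpace ℝ (Fin d)) ∞ ι)
    {δ : ℝ} (hδ : 0 < δ) :
    ∃ r₂ > 0, ∀ x : M, ∀ r, 0 ≤ r → r ≤ r₂ →
      ENNReal.ofReal (unitBallVol m * r ^ m) ≤
        ENNReal.ofReal ((1 + δ) ^ m) * vol m ι {y | dist (ι x) (ι y) ≤ (1 + δ) * r} := by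
  obtain ⟨r₂, hr₂, C, -, h⟩ := exists_uniform_of_local (X := M) (Q := fun x r₂ _ =>
    ∀ r, 0 ≤ r → r ≤ r₂ → ENNReal.ofReal (unitBallVol m * r ^ m) ≤
        ENNReal.ofReal ((1 + δ) ^ m) * vol m ι {y | dist (ι x) (ι y) ≤ (1 + δ) * r})
    (fun x r r' C C' hr hC h s hs hsr => h s hs (hsr.trans hr)) (fun x₀ => by
      obtain ⟨g, D, a₀, ρ, c, K, h, hg, r₀, hr₀, hsurj⟩ := exists_localParam hι x₀
      obtain ⟨r₂, hr₂, hball⟩ := h.volume_closedBall_le hδ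
      refine ⟨r₂, hr₂, 0, ?_⟩
      filter_upwards [hι.isEmbedding.continuous.continuousAt.preimage_mem_nhds
        (Metric.ball_mem_nhds (ι x₀) hr₀)] with x hx r hr0 hr
      obtain ⟨a, ha, rfl⟩ := hsurj x hx
      rw [← volume_real_closedBall hr0, measureReal_def,
        ENNReal.ofReal_toReal Metric.isBounded_closedBall.measure_lt_top.ne, vol_apply hι,
        ENNReal.ofReal_pow (by positivity)]
      refine (hball a ha r hr0 hr).trans ?_
      gcongr
      rintro _ ⟨⟨b, hb, rfl⟩, hbr⟩
      refine ⟨g b, ?_, rfl⟩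
      change dist (ι (g a)) (ι (g b)) ≤ _
      rwa [dist_comm, dist_eq_norm])
  exact ⟨r₂, hr₂, h⟩

end Volume

/-! ### Concentration for sample counts. -/

section Concentration

variable {Ω : Type*} [MeasurableSpace Ω] {P : Measure Ω} [IsProbabilityMeasure P]

/-- From `1 + x ≤ e^x` and `e^θ - 1 - θ ≤ θ²`. Keeping `P(E)` in the exponent is what makes the
variance of order `k` rather than `n`. -/
theorem mgf_centered_indicator_le {E : Set Ω} (hE : MeasurableSet E) {θ : ℝ} (hθ : |θ| ≤ 1) :
    mgf (fun w => E.indicator (fun _ => (1 : ℝ)) w - P.real E) P θ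
      ≤ Real.exp (P.real E * θ ^ 2) := by
  have h1 : ∀ w, Real.exp (θ * (E.indicator (fun _ => (1 : ℝ)) w - P.real E)) =
      Real.exp (-(θ * P.real E)) * (1 + (Real.exp θ - 1) * E.indicator (fun _ => (1 : ℝ)) w) := by
    intro w
    rw [mul_sub, sub_eq_neg_add, Real.exp_add]
    by_cases h : w ∈ E <;> simp [h]
  have hint : Integrable (E.indicator (fun _ => (1 : ℝ))) P := (integrable_const 1).indicator hE
  have h2 : mgf (fun w => E.indicator (fun _ => (1 : ℝ)) w - P.real E) P θ =
      Real.exp (-(θ * P.real E)) * (1 + (Real.exp θ - 1) * P.real E) := by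
    simp only [mgf, h1]
    rw [integral_const_mul, integral_add (integrable_const _) (hint.const_mul _),
      integral_const_mul, integral_indicator_const _ hE]
    simp
  rw [h2]
  have h3 := Real.add_one_le_exp ((Real.exp θ - 1) * P.real E)
  have h4 := (abs_le.1 (Real.abs_exp_sub_one_sub_id_le hθ)).2
  calc Real.exp (-(θ * P.real E)) * (1 + (Real.exp θ - 1) * P.real E)
      ≤ Real.exp (-(θ * P.real E)) * Real.exp ((Real.exp θ - 1) * P.real E) := by
        gcongr; linarith
    _ = Real.exp (P.real E * (Real.exp θ - 1 - θ)) := by rw [← Real.exp_add]; ring_nf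
    _ ≤ _ := by gcongr

/-- Bernstein's inequality for sums of independent indicators. -/
theorem measure_abs_sum_indicator_ge_le {κ : Type*} {E : κ → Set Ω}
    (hE : ∀ i, MeasurableSet (E i))
    (hind : iIndepFun (fun i => (E i).indicator (fun _ => (1 : ℝ))) P) (T : Finset κ) {V l : ℝ}
    (hV : ∑ i ∈ T, P.real (E i) ≤ V) (hl : 0 < l) (hlV : l ≤ 2 * V) :
    P {w | l ≤ |∑ i ∈ T, ((E i).indicator (fun _ => (1 : ℝ)) w - P.real (E i))|} ≤
      ENNReal.ofReal (2 * Real.exp (-(l ^ 2 / (4 * V)))) := by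
  have hV0 : 0 < V := by linarith
  set Y : κ → Ω → ℝ := fun i w => (E i).indicator (fun _ => (1 : ℝ)) w - P.real (E i) with hY
  have hYm : ∀ i, Measurable (Y i) := fun i =>
    (measurable_const.indicator (hE i)).sub_const _
  have hYind : iIndepFun Y P :=
    hind.comp (fun i x => x - P.real (E i)) fun i => by fun_prop
  have hmgf : ∀ θ : ℝ, |θ| ≤ 1 → mgf (∑ i ∈ T, Y i) P θ ≤ Real.exp (V * θ ^ 2) := by
    intro θ hθ
    rw [hYind.mgf_sum hYm]
    calc ∏ i ∈ T, mgf (Y i) P θ ≤ ∏ i ∈ T, Real.exp (P.real (E i) * θ ^ 2) :=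
          Finset.prod_le_prod (fun i _ => mgf_nonneg) fun i _ => mgf_centered_indicator_le (hE i) hθ
      _ = Real.exp ((∑ i ∈ T, P.real (E i)) * θ ^ 2) := by rw [← Real.exp_sum, Finset.sum_mul]
      _ ≤ _ := by gcongr
  have hYb : ∀ i w, |Y i w| ≤ 1 := by
    intro i w
    have h1 : P.real (E i) ≤ 1 := measureReal_le_one
    have h0 : 0 ≤ P.real (E i) := measureReal_nonneg
    rw [abs_le]
    by_cases h : w ∈ E i <;> simp only [hY, indicator_of_mem, h, indicator_of_notMem,
      not_false_eq_true] <;> constructor <;> linarith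
  have hSm : Measurable (∑ i ∈ T, Y i) := by
    rw [show ∑ i ∈ T, Y i = fun w => ∑ i ∈ T, Y i w from funext fun w => Finset.sum_apply _ _ _]
    exact Finset.measurable_sum _ fun i _ => hYm i
  have hint : ∀ θ : ℝ, Integrable (fun w => Real.exp (θ * (∑ i ∈ T, Y i) w)) P := fun θ => by
    refine integrable_exp_mul_of_mem_Icc (a := -T.card) (b := T.card) hSm.aemeasurable
      (Filter.Eventually.of_forall fun w => ?_)
    rw [mem_Icc, ← abs_le, Finset.sum_apply]
    refine (Finset.abs_sum_le_sum_abs _ _).trans ?_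
    calc ∑ i ∈ T, |Y i w| ≤ ∑ i ∈ T, (1 : ℝ) := Finset.sum_le_sum fun i _ => hYb i w
      _ = T.card := by simp
  -- The minimizer of `-θ l + V θ²`; `l ≤ 2V` says exactly that `θ ≤ 1`.
  set θ : ℝ := l / (2 * V) with hθ
  have hθ0 : 0 ≤ θ := by positivity
  have hθ1 : θ ≤ 1 := by rw [hθ, div_le_one (by positivity)]; linarith
  have hexp : -θ * l + V * θ ^ 2 = -(l ^ 2 / (4 * V)) := by
    rw [hθ]; field_simp; ring
  have hup : P.real {w | l ≤ (∑ i ∈ T, Y i) w} ≤ Real.exp (-(l ^ 2 / (4 * V))) := by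
    refine (measure_ge_le_exp_mul_mgf l hθ0 (hint θ)).trans ?_
    rw [← hexp, Real.exp_add]
    gcongr
    exact hmgf θ (by rw [abs_of_nonneg hθ0]; exact hθ1)
  have hlow : P.real {w | (∑ i ∈ T, Y i) w ≤ -l} ≤ Real.exp (-(l ^ 2 / (4 * V))) := by
    refine (measure_le_le_exp_mul_mgf (-l) (neg_nonpos.2 hθ0) (hint (-θ))).trans ?_
    rw [← hexp, Real.exp_add]
    have := hmgf (-θ) (by rw [abs_neg, abs_of_nonneg hθ0]; exact hθ1)
    rw [neg_sq] at this
    rw [show - -θ * -l = -θ * l by ring]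
    gcongr
  have hset : {w | l ≤ |∑ i ∈ T, ((E i).indicator (fun _ => (1 : ℝ)) w - P.real (E i))|} ⊆
      {w | l ≤ (∑ i ∈ T, Y i) w} ∪ {w | (∑ i ∈ T, Y i) w ≤ -l} := by
    intro w hw
    have hw : l ≤ |∑ i ∈ T, Y i w| := hw
    rw [← Finset.sum_apply, le_abs] at hw
    exact hw.imp id fun h => by simp only [mem_ofPred_eq]; linarith
  refine (measure_mono hset).trans ((measure_union_le _ _).trans ?_)
  rw [two_mul, ENNReal.ofReal_add (by positivity) (by positivity)]
  gcongr
  · rw [← ofReal_measureReal]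
    exact ENNReal.ofReal_le_ofReal hup
  · rw [← ofReal_measureReal]
    exact ENNReal.ofReal_le_ofReal hlow

variable {M : Type*} [MeasurableSpace M] {μ : Measure M}

theorem measure_abs_sum_sample_ge_le {κ : Type*} {X : κ → Ω → M} (hX : ∀ i, Measurable (X i))
    (hind : iIndepFun X P) (hlaw : ∀ i, P.map (X i) = μ) {A : Set M} (hA : MeasurableSet A)
    (T : Finset κ) {V l : ℝ} (hV : T.card * μ.real A ≤ V) (hl : 0 < l) (hlV : l ≤ 2 * V) :
    P {w | l ≤ |∑ i ∈ T, (A.indicator (fun _ => (1 : ℝ)) (X i w) - μ.real A)|} ≤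
      ENNReal.ofReal (2 * Real.exp (-(l ^ 2 / (4 * V)))) := by
  have hE : ∀ i, P.real (X i ⁻¹' A) = μ.real A := fun i => by
    rw [measureReal_def, ← Measure.map_apply (hX i) hA, hlaw i, measureReal_def]
  have h := measure_abs_sum_indicator_ge_le (P := P) (E := fun i => X i ⁻¹' A)
    (fun i => hX i hA)
    (hind.comp (fun _ => A.indicator (fun _ => (1 : ℝ))) fun _ => measurable_const.indicator hA)
    T (V := V) (l := l) (by simpa [hE] using hV) hl hlV
  simp only [hE] at h
  exact h

variable [IsProbabilityMeasure μ]

/-- Concentration of the number of sample points in a set that depends on finitely many other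
sample points. -/
theorem measure_abs_sum_random_set_ge_le {κ : Type*} [Fintype κ] [DecidableEq κ] {X : κ → Ω → M}
    (hX : ∀ i, Measurable (X i))
    (hind : iIndepFun X P) (hlaw : ∀ i, P.map (X i) = μ) (S : Finset κ) {A : Set ((S → M) × M)}
    (hA : MeasurableSet A) {V l : ℝ}
    (hV : ∀ y, Fintype.card κ * μ.real (Prod.mk y ⁻¹' A) ≤ V) (hl : 0 < l) (hlV : l ≤ 2 * V) :
    P {w | l ≤ |∑ i ∈ Sᶜ, (A.indicator (fun _ => (1 : ℝ)) (fun s : S => X s w, X i w)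
        - μ.real (Prod.mk (fun s : S => X s w) ⁻¹' A))|} ≤
      ENNReal.ofReal (2 * Real.exp (-(l ^ 2 / (4 * V)))) := by
  let U : Ω → S → M := fun w s => X s w
  let W : Ω → (Sᶜ : Finset κ) → M := fun w s => X s w
  have hU : Measurable U := measurable_pi_lambda _ fun s => hX s
  have hW : Measurable W := measurable_pi_lambda _ fun s => hX s
  -- By independence and Fubini, the points indexed by `S` can be frozen, which makes the set
  -- deterministic for the others.
  have hUW : IndepFun U W P := hind.indepFun_finset S Sᶜ disjoint_compl_right hX
  have hprod := (indepFun_iff_map_prod_eq_prod_map_map hU.aemeasurable hW.aemeasurable).1 hUW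
  let B : Set ((S → M) × ((Sᶜ : Finset κ) → M)) :=
    {q | l ≤ |∑ i : (Sᶜ : Finset κ), (A.indicator (fun _ => (1 : ℝ)) (q.1, q.2 i)
        - μ.real (Prod.mk q.1 ⁻¹' A))|}
  have hB : MeasurableSet B := by
    refine measurableSet_le measurable_const (Measurable.abs ?_)
    refine Finset.measurable_sum _ fun i _ => Measurable.sub ?_ ?_
    · exact (measurable_const.indicator hA).comp
        (measurable_fst.prodMk ((measurable_pi_apply i).comp measurable_snd))
    · exact ((measurable_measure_prodMk_left hA).comp measurable_fst).ennreal_toReal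
  have hev : {w | l ≤ |∑ i ∈ Sᶜ, (A.indicator (fun _ => (1 : ℝ)) (fun s : S => X s w, X i w)
        - μ.real (Prod.mk (fun s : S => X s w) ⁻¹' A))|} = (fun w => (U w, W w)) ⁻¹' B := by
    ext w
    simp only [B, U, W, mem_ofPred_eq, mem_preimage]
    rw [← Finset.sum_coe_sort Sᶜ]
  rw [hev, ← Measure.map_apply (hU.prodMk hW) hB, hprod, Measure.prod_apply hB]
  have : IsProbabilityMeasure (P.map U) := Measure.isProbabilityMeasure_map hU.aemeasurable
  refine (lintegral_mono (g := fun _ => ENNReal.ofReal (2 * Real.exp (-(l ^ 2 / (4 * V)))))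
    fun y => ?_).trans_eq (by simp)
  rw [Measure.map_apply hW (measurable_prodMk_left hB)]
  have h := measure_abs_sum_sample_ge_le hX hind hlaw (A := Prod.mk y ⁻¹' A)
    (measurable_prodMk_left hA) Sᶜ (V := V) (l := l) (le_trans (by
      gcongr
      exact Finset.card_le_univ _) (hV y)) hl hlV
  refine (measure_mono ?_).trans h
  intro w hw
  simp only [B, W, mem_ofPred_eq, mem_preimage] at hw
  rw [mem_ofPred_eq, ← Finset.sum_coe_sort Sᶜ]
  exact hw

theorem measure_preimage_eq_zero_of_null {κ : Type*} {X : κ → Ω → M} (hX : ∀ i, Measurable (X i))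
    (hind : iIndepFun X P) (hlaw : ∀ i, P.map (X i) = μ) {i j : κ} (hij : i ≠ j)
    {A : Set (M × M)} (hA : MeasurableSet A) (hnull : ∀ y, μ (Prod.mk y ⁻¹' A) = 0) :
    P {w | (X i w, X j w) ∈ A} = 0 := by
  have hprod := (indepFun_iff_map_prod_eq_prod_map_map (hX i).aemeasurable
    (hX j).aemeasurable).1 (hind.indepFun hij)
  change P ((fun w => (X i w, X j w)) ⁻¹' A) = 0
  rw [← Measure.map_apply ((hX i).prodMk (hX j)) hA, hprod, hlaw, hlaw,
    Measure.prod_apply hA]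
  simp [hnull]

end Concentration

/-! ### Nearest-neighbor radii, densities, weights and Lipschitz seminorms. -/

section NearestNeighbours

variable {d n k : ℕ} {M : Type*} {ι : M → EuclideanSpace ℝ (Fin d)} {X : Fin n → M}

/-- The count jumps only at sample distances, so the infimum is attained at one. This reduces random
radii to finitely many choices of an index. -/
theorem exists_knnRadius_eq (hk : 1 ≤ k) {x : M} {R : ℝ} (hR : 0 < R)
    (h : k ≤ ballCount ι X x R) :
    knnRadius ι k X x ≤ R ∧ ∃ a, 0 < dist (ι (X a)) (ι x) ∧
      knnRadius ι k X x = dist (ι (X a)) (ι x) := by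
  let V : Set (Fin n) := {a | 0 < dist (ι (X a)) (ι x) ∧
    k ≤ ballCount ι X x (dist (ι (X a)) (ι x))}
  have key : ∀ ε, k ≤ ballCount ι X x ε → ∃ a ∈ V, dist (ι (X a)) (ι x) ≤ ε := by
    intro ε hε
    let W : Set (Fin n) := {i | 0 < dist (ι (X i)) (ι x) ∧ dist (ι (X i)) (ι x) ≤ ε}
    have hW : W.Nonempty := by
      rw [← ncard_pos]
      exact lt_of_lt_of_le hk hε
    obtain ⟨a, ha, hmax⟩ := exists_max_image W (fun i => dist (ι (X i)) (ι x)) W.toFinite hW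
    refine ⟨a, ⟨ha.1, hε.trans (ncard_le_ncard ?_)⟩, ha.2⟩
    exact fun i hi => ⟨hi.1, hmax i hi⟩
  obtain ⟨a₀, ha₀, -⟩ := key R h
  obtain ⟨a, ha, hmin⟩ := exists_min_image V (fun i => dist (ι (X i)) (ι x)) V.toFinite ⟨a₀, ha₀⟩
  have hleast : IsLeast {ε : ℝ | 0 < ε ∧ k ≤ ballCount ι X x ε} (dist (ι (X a)) (ι x)) := by
    refine ⟨ha, fun ε hε => ?_⟩
    obtain ⟨a', ha', hle⟩ := key ε hε.2
    exact (hmin a' ha').trans hle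
  have heq : knnRadius ι k X x = dist (ι (X a)) (ι x) := hleast.csInf_eq
  exact ⟨heq ▸ hleast.2 ⟨hR, h⟩, a, ha.1, heq⟩

end NearestNeighbours

section Density

variable {m d : ℕ} {M : Type*} [MeasurableSpace M] {ι : M → EuclideanSpace ℝ (Fin d)} {p : M → ℝ}

theorem densityMeasure_le {B : ℝ} (hB : ∀ x, p x ≤ B) {s : Set M} (hs : MeasurableSet s) :
    densityMeasure m ι p s ≤ ENNReal.ofReal B * vol m ι s := by
  rw [densityMeasure, withDensity_apply _ hs, ← setLIntegral_const]
  exact lintegral_mono fun x => ENNReal.ofReal_le_ofReal (hB x)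

theorem le_densityMeasure {b : ℝ} (hb : ∀ x, b ≤ p x) {s : Set M} (hs : MeasurableSet s) :
    ENNReal.ofReal b * vol m ι s ≤ densityMeasure m ι p s := by
  rw [densityMeasure, withDensity_apply _ hs, ← setLIntegral_const]
  exact lintegral_mono fun x => ENNReal.ofReal_le_ofReal (hb x)

theorem setIntegral_density (hpm : Measurable p) (hp : ∀ x, 0 < p x) {s : Set M}
    (hs : MeasurableSet s) : ∫ x in s, p x ∂(vol m ι) = (densityMeasure m ι p).real s := by
  rw [integral_eq_lintegral_of_nonneg_ae (Filter.Eventually.of_forall fun x => (hp x).le)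
    hpm.aestronglyMeasurable, measureReal_def, densityMeasure, withDensity_apply _ hs]

theorem integrable_density [IsProbabilityMeasure (densityMeasure m ι p)] (hpm : Measurable p)
    (hp : ∀ x, 0 < p x) : Integrable p (vol m ι) := by
  refine ⟨hpm.aestronglyMeasurable, ?_⟩
  have h1 : ∫⁻ x, ‖p x‖ₑ ∂(vol m ι) = densityMeasure m ι p univ := by
    rw [densityMeasure, withDensity_apply _ MeasurableSet.univ, Measure.restrict_univ]
    exact lintegral_congr fun x => Real.enorm_of_nonneg (hp x).le
  rw [HasFiniteIntegral, h1, measure_univ]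
  exact ENNReal.one_lt_top

end Density

theorem eta_nonneg (t : ℝ) : 0 ≤ eta t := indicator_nonneg (fun _ _ => zero_le_one) t

theorem eta_le_one (t : ℝ) : eta t ≤ 1 := indicator_le_self' (fun _ _ => zero_le_one) t

theorem eta_div {a r : ℝ} (ha : 0 ≤ a) (hr : 0 < r) :
    eta (a / r) = if a ≤ r then 1 else 0 := by
  have h : a / r ∈ Icc (0 : ℝ) 1 ↔ a ≤ r := by
    rw [mem_Icc, div_le_one hr]
    exact ⟨fun h => h.2, fun h => ⟨by positivity, h⟩⟩
  unfold eta
  split_ifs with h1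
  · rw [indicator_of_mem (h.2 h1)]
  · rw [indicator_of_notMem fun h2 => h1 (h.1 h2)]

variable {m d : ℕ} {M : Type*} [TopologicalSpace M] [ChartedSpace (EuclideanSpace ℝ (Fin m)) M]
  {ι : M → EuclideanSpace ℝ (Fin d)}

theorem geodDist_nonneg (ι : M → EuclideanSpace ℝ (Fin d)) (x y : M) :
    0 ≤ geodDist (m := m) ι x y := ENNReal.toReal_nonneg

section Weight

variable [MeasurableSpace M] {p : M → ℝ} {n k : ℕ} {X : Fin n → M}

theorem wk_nonneg (hp : ∀ x, 0 < p x) (x y : M) : 0 ≤ wk (m := m) ι p k X x y :=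
  integral_nonneg fun z => mul_nonneg (mul_nonneg (eta_nonneg _) (eta_nonneg _)) (hp z).le

theorem wk_le_one [IsProbabilityMeasure (densityMeasure m ι p)] (hpm : Measurable p)
    (hp : ∀ x, 0 < p x) (x y : M) : wk (m := m) ι p k X x y ≤ 1 := by
  have h1 : ∫ z, p z ∂(vol m ι) = 1 := by
    rw [← setIntegral_univ, setIntegral_density hpm hp MeasurableSet.univ]
    simp
  rw [← h1]
  refine integral_mono_of_nonneg (Filter.Eventually.of_forall fun z =>
    mul_nonneg (mul_nonneg (eta_nonneg _) (eta_nonneg _)) (hp z).le) (integrable_density hpm hp)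
    (Filter.Eventually.of_forall fun z => ?_)
  exact mul_le_of_le_one_left (hp z).le (mul_le_one₀ (eta_le_one _) (eta_nonneg _) (eta_le_one _))

/-- Positive radii matter: division by `0` gives `0`, where `eta` is `1`, so a zero radius would
select all of `M`. -/
theorem wk_eq [BorelSpace M] (hpm : Measurable p) (hp : ∀ x, 0 < p x)
    (hc : ∀ x, Continuous (geodDist (m := m) ι x)) {x y : M}
    (hx : 0 < knnRadius ι k X x) (hy : 0 < knnRadius ι k X y) :
    wk (m := m) ι p k X x y = (densityMeasure m ι p).real
      ({z | geodDist (m := m) ι x z ≤ knnRadius ι k X x} ∩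
        {z | geodDist (m := m) ι y z ≤ knnRadius ι k X y}) := by
  have hs : MeasurableSet ({z | geodDist (m := m) ι x z ≤ knnRadius ι k X x} ∩
      {z | geodDist (m := m) ι y z ≤ knnRadius ι k X y}) :=
    ((isClosed_le (hc x) continuous_const).inter
      (isClosed_le (hc y) continuous_const)).measurableSet
  rw [← setIntegral_density hpm hp hs, ← integral_indicator hs]
  refine integral_congr_ae (Filter.Eventually.of_forall fun z => ?_)
  simp only [eta_div (geodDist_nonneg ι _ _) hx, eta_div (geodDist_nonneg ι _ _) hy,
    indicator_apply, mem_inter_iff, mem_ofPred_eq]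
  split_ifs <;> simp_all

end Weight

section Lipschitz

variable {f : M → ℝ} {r₁ C D : ℝ}

theorem lipSeminorm_nonneg (S : Set M) : 0 ≤ lipSeminorm (m := m) ι f S := by
  refine Real.sSup_nonneg ?_
  rintro _ ⟨y, -, z, -, -, rfl⟩
  exact div_nonneg (abs_nonneg _) (geodDist_nonneg ι y z)

theorem geodDist_pos (hG : GeodesicBounds m ι r₁ C D) (hι : Function.Injective ι) {y z : M}
    (h : y ≠ z) : 0 < geodDist (m := m) ι y z :=
  (dist_pos.2 (hι.ne h)).trans_le (hG.dist_le y z)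

theorem bddAbove_lipQuotients (hG : GeodesicBounds m ι r₁ C D) (hι : Function.Injective ι)
    (hf : IsLip (m := m) ι f) (S : Set M) :
    BddAbove {q : ℝ | ∃ y ∈ S, ∃ z ∈ S, y ≠ z ∧ q = |f y - f z| / geodDist (m := m) ι y z} := by
  obtain ⟨L, hL⟩ := hf
  refine ⟨L, ?_⟩
  rintro _ ⟨y, -, z, -, hyz, rfl⟩
  rw [div_le_iff₀ (geodDist_pos hG hι hyz)]
  exact hL y z

theorem abs_sub_le_lipSeminorm (hG : GeodesicBounds m ι r₁ C D) (hι : Function.Injective ι)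
    (hf : IsLip (m := m) ι f) {S : Set M} {y z : M} (hy : y ∈ S) (hz : z ∈ S) :
    |f y - f z| ≤ lipSeminorm (m := m) ι f S * geodDist (m := m) ι y z := by
  rcases eq_or_ne y z with rfl | hyz
  · simpa using mul_nonneg (lipSeminorm_nonneg S) (geodDist_nonneg ι y y)
  · rw [← div_le_iff₀ (geodDist_pos hG hι hyz)]
    exact le_csSup (bddAbove_lipQuotients hG hι hf S) ⟨y, hy, z, hz, hyz, rfl⟩

theorem lipSeminorm_mono (hG : GeodesicBounds m ι r₁ C D) (hι : Function.Injective ι)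
    (hf : IsLip (m := m) ι f) {S T : Set M} (hST : S ⊆ T) :
    lipSeminorm (m := m) ι f S ≤ lipSeminorm (m := m) ι f T := by
  refine Real.sSup_le ?_ (lipSeminorm_nonneg T)
  rintro _ ⟨y, hy, z, hz, hyz, rfl⟩
  exact le_csSup (bddAbove_lipQuotients hG hι hf T) ⟨y, hST hy, z, hST hz, hyz, rfl⟩

end Lipschitz

/-! ### Bounds for the sampling measure. -/

section Bounds

theorem GeodesicBounds.mono {r₁ r₂ C D : ℝ} (h : GeodesicBounds m ι r₁ C D) (h0 : 0 < r₂)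
    (h12 : r₂ ≤ r₁) : GeodesicBounds m ι r₂ C D :=
  ⟨h0, h.C_pos, h.dist_le, fun x y hxy => h.le_add_cube x y (hxy.trans_le h12), h.le_diam,
    h.continuous⟩

variable [MeasurableSpace M]

/-- Uniform geometric bounds for the measure `p dVol`: sharp lower volume bounds, upper volume
bounds, and a bound for the measure of the difference of Euclidean and geodesic balls. -/
structure SampleBounds (m : ℕ) {d : ℕ} {M : Type*} [TopologicalSpace M]
    [ChartedSpace (EuclideanSpace ℝ (Fin m)) M] [MeasurableSpace M]
    (ι : M → EuclideanSpace ℝ (Fin d)) (p : M → ℝ) (r₁ C D B δ b : ℝ) : Prop where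
  geodesic : GeodesicBounds m ι r₁ C D
  B_pos : 0 < B
  ball_le : ∀ x r, 0 < r → r ≤ r₁ →
    (densityMeasure m ι p).real {y | dist (ι x) (ι y) ≤ r} ≤ B * r ^ m
  diff_le : ∀ x r, 0 < r → r ≤ r₁ →
    (densityMeasure m ι p).real
      ({y | dist (ι x) (ι y) ≤ r} \ {y | geodDist (m := m) ι x y ≤ r}) ≤ B * r ^ (m + 2)
  le_ball : ∀ x r, 0 ≤ r → r ≤ r₁ → b * (unitBallVol m * r ^ m) ≤
    (1 + δ) ^ m * (densityMeasure m ι p).real {y | dist (ι x) (ι y) ≤ (1 + δ) * r}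

theorem exists_sampleBounds [CompactSpace M] [ConnectedSpace M] [BorelSpace M] (hm : m ≠ 0)
    (hι : Manifold.IsSmoothEmbedding (𝓡 m) 𝓘(ℝ, EuclideanSpace ℝ (Fin d)) ∞ ι) {p : M → ℝ}
    [IsProbabilityMeasure (densityMeasure m ι p)] {b B₀ : ℝ} (hb : 0 < b) (hbp : ∀ x, b ≤ p x)
    (hpB : ∀ x, p x ≤ B₀) {δ : ℝ} (hδ : 0 < δ) :
    ∃ r₁ C D B, SampleBounds m ι p r₁ C D B δ b := by
  obtain ⟨r₀, C, D, hG⟩ := exists_geodesicBounds hι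
  obtain ⟨r₂, hr₂, C₂, hC₂, hann⟩ := exists_vol_annulus_le hm hι hG.C_pos
  obtain ⟨r₃, hr₃, C₃, hC₃, hball⟩ := exists_vol_ball_le hι
  obtain ⟨r₄, hr₄, hlow⟩ := exists_le_vol_ball hι hδ
  have hr₀ := hG.r₁_pos
  have hcont := hι.isEmbedding.continuous
  obtain ⟨x₀⟩ : Nonempty M := inferInstance
  have hB₀ : 0 < B₀ := hb.trans_le ((hbp x₀).trans (hpB x₀))
  have hclosed : ∀ x r, MeasurableSet {y | dist (ι x) (ι y) ≤ r} := fun x r =>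
    (isClosed_le (by fun_prop) continuous_const).measurableSet
  have hreal : ∀ {s : Set M} {v : ℝ}, 0 ≤ v → MeasurableSet s → vol m ι s ≤ ENNReal.ofReal v →
      (densityMeasure m ι p).real s ≤ B₀ * v := by
    intro s v hv hs h
    refine ENNReal.toReal_le_of_le_ofReal (by positivity) ((densityMeasure_le hpB hs).trans ?_)
    rw [ENNReal.ofReal_mul hB₀.le]
    gcongr
  set r₁ := min (min (r₀ / 2) r₂) (min r₃ r₄) with hr₁
  have h0 : r₁ ≤ r₀ / 2 := (min_le_left _ _).trans (min_le_left _ _)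
  have h2 : r₁ ≤ r₂ := (min_le_left _ _).trans (min_le_right _ _)
  have h3 : r₁ ≤ r₃ := (min_le_right _ _).trans (min_le_left _ _)
  have h4 : r₁ ≤ r₄ := (min_le_right _ _).trans (min_le_right _ _)
  refine ⟨r₁, C, D, B₀ * (C₂ + C₃), hG.mono (by positivity) (by linarith), by positivity,
    fun x r hr hr1 => ?_, fun x r hr hr1 => ?_, fun x r hr hr1 => ?_⟩
  · refine (hreal (by positivity) (hclosed x r) (hball x r hr (hr1.trans h3))).trans ?_
    rw [← mul_assoc]
    gcongr
    linarith
  · have hmeas : MeasurableSet {y | r - C * r ^ 3 ≤ dist (ι x) (ι y) ∧ dist (ι x) (ι y) ≤ r} :=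
      MeasurableSet.inter (s₁ := {y | r - C * r ^ 3 ≤ dist (ι x) (ι y)})
        (isClosed_le continuous_const (by fun_prop)).measurableSet (hclosed x r)
    -- A geodesic distance above `r` forces a chord above `r - C r³`.
    have hsub : {y | dist (ι x) (ι y) ≤ r} \ {y | geodDist (m := m) ι x y ≤ r} ⊆
        {y | r - C * r ^ 3 ≤ dist (ι x) (ι y) ∧ dist (ι x) (ι y) ≤ r} := by
      rintro y ⟨hy1, hy2⟩
      have hy1 : dist (ι x) (ι y) ≤ r := hy1
      have hy2 : ¬ geodDist (m := m) ι x y ≤ r := hy2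
      refine ⟨?_, hy1⟩
      have := hG.le_add_cube x y (by linarith)
      have h3 : C * dist (ι x) (ι y) ^ 3 ≤ C * r ^ 3 := by
        have := hG.C_pos
        gcongr
      linarith
    refine (measureReal_mono hsub).trans
      ((hreal (by positivity) hmeas (hann x r hr (hr1.trans h2))).trans ?_)
    rw [← mul_assoc]
    gcongr
    linarith
  · have h5 := hlow x r hr (hr1.trans h4)
    have h6 := le_densityMeasure (m := m) (ι := ι) hbp (hclosed x ((1 + δ) * r))
    have h7 : ENNReal.ofReal (b * (unitBallVol m * r ^ m)) ≤ ENNReal.ofReal ((1 + δ) ^ m *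
        (densityMeasure m ι p).real {y | dist (ι x) (ι y) ≤ (1 + δ) * r}) := by
      rw [ENNReal.ofReal_mul hb.le,
        ENNReal.ofReal_mul (p := (1 + δ) ^ m) (by positivity), ofReal_measureReal]
      calc ENNReal.ofReal b * ENNReal.ofReal (unitBallVol m * r ^ m)
          ≤ ENNReal.ofReal b * (ENNReal.ofReal ((1 + δ) ^ m) *
              vol m ι {y | dist (ι x) (ι y) ≤ (1 + δ) * r}) := by gcongr
        _ = ENNReal.ofReal ((1 + δ) ^ m) * (ENNReal.ofReal b *
              vol m ι {y | dist (ι x) (ι y) ≤ (1 + δ) * r}) := by ring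
        _ ≤ _ := by gcongr
    exact (ENNReal.ofReal_le_ofReal_iff (by positivity)).1 h7

end Bounds

/-! ### Shared-neighbor counts against the weights. -/

section Counting

variable {d n k : ℕ} {M : Type*} {ι : M → EuclideanSpace ℝ (Fin d)} {X : Fin n → M}

/-- The closed Euclidean ball, as a subset of `M`. -/
def euclBall (ι : M → EuclideanSpace ℝ (Fin d)) (x : M) (r : ℝ) : Set M :=
  {z | dist (ι x) (ι z) ≤ r}

/-- Without ties, puncturing the ball removes precisely the index `i`. -/
theorem ballCount_eq_sum (hι : Function.Injective ι) (hX : Function.Injective X) (i : Fin n)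
    (r : ℝ) : (ballCount ι X (X i) r : ℝ) =
      ∑ l ∈ ({i} : Finset (Fin n))ᶜ, (euclBall ι (X i) r).indicator (fun _ => (1 : ℝ)) (X l) := by
  classical
  have h1 : {l : Fin n | 0 < dist (ι (X l)) (ι (X i)) ∧ dist (ι (X l)) (ι (X i)) ≤ r} =
      ((({i} : Finset (Fin n))ᶜ.filter fun l => X l ∈ euclBall ι (X i) r : Finset (Fin n)) :
        Set (Fin n)) := by
    ext l
    simp only [dist_pos, ne_eq, hι.eq_iff, hX.eq_iff, Finset.coe_filter, Finset.mem_compl,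
      Finset.mem_singleton, euclBall, mem_ofPred_eq, dist_comm (ι (X i))]
  rw [ballCount, h1, ncard_coe_finset, Finset.card_filter]
  push_cast
  refine Finset.sum_congr rfl fun l _ => ?_
  rw [indicator_apply]

/-- Discards the indices in `S`, on which the intersection will depend, leaving points independent
of it. -/
theorem abs_sharedCount_sub_sum_le (hX : Function.Injective X) (i j : Fin n)
    (S : Finset (Fin n)) (hi : i ∈ S) (hj : j ∈ S) :
    |(sharedCount ι k X (X j) (X i) : ℝ) - ∑ l ∈ Sᶜ, (euclBall ι (X j) (knnRadius ι k X (X j)) ∩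
      euclBall ι (X i) (knnRadius ι k X (X i))).indicator (fun _ => (1 : ℝ)) (X l)| ≤ S.card := by
  classical
  set F := euclBall ι (X j) (knnRadius ι k X (X j)) ∩ euclBall ι (X i) (knnRadius ι k X (X i))
  let N : Finset (Fin n) := Finset.univ.filter fun l => X l ≠ X j ∧ X l ≠ X i ∧ X l ∈ F
  let N' : Finset (Fin n) := Sᶜ.filter fun l => X l ∈ F
  have h1 : sharedCount ι k X (X j) (X i) = N.card := by
    rw [sharedCount, ← ncard_coe_finset]
    congr 1
    ext l
    simp only [N, F, Finset.coe_filter, Finset.mem_univ, true_and, euclBall, mem_inter_iff,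
      mem_ofPred_eq]
  have h2 : ∑ l ∈ Sᶜ, F.indicator (fun _ => (1 : ℝ)) (X l) = N'.card := by
    rw [Finset.card_filter]
    push_cast
    exact Finset.sum_congr rfl fun l _ => by rw [indicator_apply]
  have h3 : N'.card ≤ N.card := by
    refine Finset.card_le_card fun l hl => ?_
    simp only [N', N, Finset.mem_filter, Finset.mem_compl, Finset.mem_univ, true_and] at hl ⊢
    refine ⟨fun h => hl.1 ?_, fun h => hl.1 ?_, hl.2⟩
    · rwa [hX h]
    · rwa [hX h]
  have h4 : N.card ≤ N'.card + S.card := by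
    refine (Finset.card_le_card fun l hl => ?_).trans (Finset.card_union_le N' S)
    simp only [N', N, Finset.mem_filter, Finset.mem_compl, Finset.mem_univ, true_and,
      Finset.mem_union] at hl ⊢
    by_cases hlS : l ∈ S
    · exact Or.inr hlS
    · exact Or.inl ⟨hlS, hl.2.2⟩
  rw [h1, h2, abs_le]
  have h3' : (N'.card : ℝ) ≤ N.card := by exact_mod_cast h3
  have h4' : (N.card : ℝ) ≤ N'.card + S.card := by exact_mod_cast h4
  have : (0 : ℝ) ≤ S.card := by positivity
  constructor <;> linarith

theorem sharedCount_le (x y : M) : sharedCount ι k X x y ≤ n := by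
  refine (ncard_le_ncard (subset_univ _)).trans_eq ?_
  rw [ncard_univ, Nat.card_eq_fintype_card, Fintype.card_fin]

theorem sharedCount_eq_zero {x y : M}
    (h : knnRadius ι k X x + knnRadius ι k X y < dist (ι x) (ι y)) :
    sharedCount ι k X x y = 0 := by
  rw [sharedCount, ncard_eq_zero, eq_empty_iff_forall_notMem]
  rintro l ⟨-, -, h1, h2⟩
  have := dist_triangle_right (ι x) (ι y) (ι (X l))
  linarith

end Counting

section Difference

variable {m d n k : ℕ} {M : Type*} [TopologicalSpace M]
  [ChartedSpace (EuclideanSpace ℝ (Fin m)) M] [MeasurableSpace M]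
  {ι : M → EuclideanSpace ℝ (Fin d)} {p : M → ℝ} {X : Fin n → M}

theorem snnLaplacian_sub_L1 (hn : n ≠ 0) (hk : k ≠ 0) (u : Fin n → ℝ) (j : Fin n) :
    snnLaplacian m ι k X u j - L1 (m := m) ι p k X u j =
      (unitBallVol m * n / k) ^ (1 + 2 / (m : ℝ)) / (2 ^ (m + 2) * k * n) *
        ∑ i, ((sharedCount ι k X (X j) (X i) : ℝ) - n * wk (m := m) ι p k X (X j) (X i)) *
          (u j - u i) := by
  have hn' : (n : ℝ) ≠ 0 := by exact_mod_cast hn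
  have hk' : (k : ℝ) ≠ 0 := by exact_mod_cast hk
  rw [snnLaplacian, L1]
  simp only [sub_mul _ _ (u j - u _), Finset.sum_sub_distrib, div_mul_eq_mul_div, mul_assoc (n : ℝ),
    ← Finset.mul_sum, ← Finset.sum_div]
  field_simp

/-- The index `j` is exempt from `h0` because its increment vanishes. -/
theorem abs_snnLaplacian_sub_L1_le (hn : n ≠ 0) (hk : k ≠ 0) (u : Fin n → ℝ) (j : Fin n)
    {E U : ℝ} {I : Finset (Fin n)} (hE : 0 ≤ E)
    (h0 : ∀ i ∉ I, i ≠ j → (sharedCount ι k X (X j) (X i) : ℝ) = 0 ∧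
      wk (m := m) ι p k X (X j) (X i) = 0)
    (h : ∀ i ∈ I, |(sharedCount ι k X (X j) (X i) : ℝ) - n * wk (m := m) ι p k X (X j) (X i)| ≤ E)
    (hU : ∀ i ∈ I, |u j - u i| ≤ U) :
    |snnLaplacian m ι k X u j - L1 (m := m) ι p k X u j| ≤
      (unitBallVol m * n / k) ^ (1 + 2 / (m : ℝ)) / (2 ^ (m + 2) * k * n) *
        (I.card * (E * U)) := by
  have hα := unitBallVol_pos m
  rw [snnLaplacian_sub_L1 hn hk, abs_mul, abs_of_nonneg (by positivity)]
  gcongr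
  rw [← Finset.sum_subset (Finset.subset_univ I) fun i _ hi => ?_]
  · refine (Finset.abs_sum_le_sum_abs _ _).trans ?_
    rw [← nsmul_eq_mul]
    refine Finset.sum_le_card_nsmul _ _ _ fun i hi => ?_
    rw [abs_mul]
    exact mul_le_mul (h i hi) (hU i hi) (abs_nonneg _) hE
  · rcases eq_or_ne i j with rfl | hij
    · simp
    · rw [(h0 i hi hij).1, (h0 i hi hij).2]; simp

end Difference

section Overlap

variable {m d n k : ℕ} {M : Type*} [TopologicalSpace M]
  [ChartedSpace (EuclideanSpace ℝ (Fin m)) M] [MeasurableSpace M] [BorelSpace M]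
  {ι : M → EuclideanSpace ℝ (Fin d)} {p : M → ℝ}
  {r₁ C D B δ b : ℝ} {X : Fin n → M}

theorem wk_eq_zero (hpm : Measurable p) (hp : ∀ x, 0 < p x)
    (hG : GeodesicBounds m ι r₁ C D) {x y : M}
    (hx : 0 < knnRadius ι k X x) (hy : 0 < knnRadius ι k X y)
    (h : knnRadius ι k X x + knnRadius ι k X y < dist (ι x) (ι y)) :
    wk (m := m) ι p k X x y = 0 := by
  rw [wk_eq hpm hp hG.continuous hx hy]
  convert measureReal_empty
  rw [eq_empty_iff_forall_notMem]
  rintro z ⟨h1, h2⟩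
  have h1 : geodDist (m := m) ι x z ≤ _ := h1
  have h2 : geodDist (m := m) ι y z ≤ _ := h2
  have h3 := dist_triangle_right (ι x) (ι y) (ι z)
  linarith [hG.dist_le x z, hG.dist_le y z]

variable [IsProbabilityMeasure (densityMeasure m ι p)]

/-- Replacing Euclidean by geodesic balls changes the measure of the overlap of two balls by a term
of relative order two. -/
theorem abs_overlap_sub_wk_le (hS : SampleBounds m ι p r₁ C D B δ b)
    (hpm : Measurable p) (hp : ∀ x, 0 < p x) {R : ℝ} (hR : R ≤ r₁) {x y : M}
    (hx : 0 < knnRadius ι k X x) (hy : 0 < knnRadius ι k X y)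
    (hxR : knnRadius ι k X x ≤ R) (hyR : knnRadius ι k X y ≤ R) :
    |(densityMeasure m ι p).real
        (euclBall ι x (knnRadius ι k X x) ∩ euclBall ι y (knnRadius ι k X y))
      - wk (m := m) ι p k X x y| ≤ 2 * (B * R ^ (m + 2)) := by
  rw [wk_eq hpm hp hS.geodesic.continuous hx hy]
  set r := knnRadius ι k X x
  set s := knnRadius ι k X y
  set μ := densityMeasure m ι p
  set G₁ := {z | geodDist (m := m) ι x z ≤ r}
  set G₂ := {z | geodDist (m := m) ι y z ≤ s}
  have h1 : μ.real (G₁ ∩ G₂) ≤ μ.real (euclBall ι x r ∩ euclBall ι y s) :=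
    measureReal_mono fun z hz => ⟨(hS.geodesic.dist_le x z).trans hz.1,
      (hS.geodesic.dist_le y z).trans hz.2⟩
  have hsub : euclBall ι x r ∩ euclBall ι y s ⊆
      (G₁ ∩ G₂) ∪ ((euclBall ι x r \ G₁) ∪ (euclBall ι y s \ G₂)) := by
    rintro z ⟨hz1, hz2⟩
    by_cases h1 : z ∈ G₁
    · by_cases h2 : z ∈ G₂
      · exact Or.inl ⟨h1, h2⟩
      · exact Or.inr (Or.inr ⟨hz2, h2⟩)
    · exact Or.inr (Or.inl ⟨hz1, h1⟩)
  have h2 : μ.real (euclBall ι x r ∩ euclBall ι y s) ≤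
      μ.real (G₁ ∩ G₂) + (μ.real (euclBall ι x r \ G₁) + μ.real (euclBall ι y s \ G₂)) :=
    (measureReal_mono hsub).trans ((measureReal_union_le _ _).trans
      (add_le_add_right (measureReal_union_le _ _) _))
  have h3 : μ.real (euclBall ι x r \ G₁) ≤ B * R ^ (m + 2) := by
    refine (hS.diff_le x r hx (hxR.trans hR)).trans ?_
    have := hS.B_pos
    gcongr
  have h4 : μ.real (euclBall ι y s \ G₂) ≤ B * R ^ (m + 2) := by
    refine (hS.diff_le y s hy (hyR.trans hR)).trans ?_
    have := hS.B_pos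
    gcongr
  rw [abs_le]
  constructor <;> linarith

/-- The `8` is `4 + 4`: at most four indices leave the count, and the mean has `n - |S|` terms
instead of `n`. -/
theorem abs_sharedCount_sub_wk_le (hS : SampleBounds m ι p r₁ C D B δ b)
    (hpm : Measurable p) (hp : ∀ x, 0 < p x)
    (hX : Function.Injective X) (hk : 1 ≤ k) {R l : ℝ} (hR0 : 0 < R) (hR : R ≤ r₁)
    (hball : ∀ i, k ≤ ballCount ι X (X i) R) {i j : Fin n}
    (hov : ∀ a b, dist (ι (X a)) (ι (X j)) ≤ R → dist (ι (X b)) (ι (X i)) ≤ R →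
      |∑ c ∈ ({j, i, a, b} : Finset (Fin n))ᶜ,
        ((euclBall ι (X j) (dist (ι (X a)) (ι (X j))) ∩
          euclBall ι (X i) (dist (ι (X b)) (ι (X i)))).indicator (fun _ => (1 : ℝ)) (X c) -
        (densityMeasure m ι p).real (euclBall ι (X j) (dist (ι (X a)) (ι (X j))) ∩
          euclBall ι (X i) (dist (ι (X b)) (ι (X i)))))| ≤ l) :
    |(sharedCount ι k X (X j) (X i) : ℝ) - n * wk (m := m) ι p k X (X j) (X i)| ≤
      l + 8 + n * (2 * (B * R ^ (m + 2))) := by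
  obtain ⟨hjR, a, ha0, ha⟩ := exists_knnRadius_eq hk hR0 (hball j)
  obtain ⟨hiR, b, hb0, hb⟩ := exists_knnRadius_eq hk hR0 (hball i)
  have h1 := hov a b (ha ▸ hjR) (hb ▸ hiR)
  have h2 := abs_overlap_sub_wk_le hS hpm hp hR (ha ▸ ha0) (hb ▸ hb0) hjR hiR
  rw [← ha, ← hb] at h1
  set S : Finset (Fin n) := {j, i, a, b} with hSdef
  have h3 := abs_sharedCount_sub_sum_le (ι := ι) (k := k) hX i j S (by simp [S]) (by simp [S])
  have hScard : (S.card : ℝ) ≤ 4 := by exact_mod_cast Finset.card_le_four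
  set F := euclBall ι (X j) (knnRadius ι k X (X j)) ∩ euclBall ι (X i) (knnRadius ι k X (X i))
  rw [Finset.sum_sub_distrib, Finset.sum_const, nsmul_eq_mul] at h1
  set π := (densityMeasure m ι p).real F
  have hπ0 : 0 ≤ π := measureReal_nonneg
  have hπ1 : π ≤ 1 := measureReal_le_one
  have hc : (Sᶜ.card : ℝ) = n - S.card := by
    rw [Finset.card_compl, Nat.cast_sub (Finset.card_le_univ S), Fintype.card_fin]
  rw [hc] at h1
  have h4 : |(n : ℝ) * π - n * wk (m := m) ι p k X (X j) (X i)| ≤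
      n * (2 * (B * R ^ (m + 2))) := by
    rw [← mul_sub, abs_mul, Nat.abs_cast]
    gcongr
  have h5 : (S.card : ℝ) * π ≤ 4 := by nlinarith [Nat.cast_nonneg (α := ℝ) S.card]
  have h6 : 0 ≤ (S.card : ℝ) * π := by positivity
  rw [abs_le] at h1 h3 h4 ⊢
  constructor <;> nlinarith

end Overlap

/-! ### Deviation events for one ball and for two intersecting balls. -/

section Events

variable {m d n : ℕ} {M : Type*} [TopologicalSpace M] [MeasurableSpace M] [BorelSpace M]
  {ι : M → EuclideanSpace ℝ (Fin d)} {p : M → ℝ}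
  {Ω : Type*} [MeasurableSpace Ω] {P : Measure Ω} [IsProbabilityMeasure P]
  [IsProbabilityMeasure (densityMeasure m ι p)] {X : Fin n → Ω → M}

theorem measure_ballCount_deviation_le (hι : Continuous ι) (hX : ∀ i, Measurable (X i))
    (hind : iIndepFun X P) (hlaw : ∀ i, P.map (X i) = densityMeasure m ι p) (i : Fin n)
    {R V l : ℝ} (hV : ∀ x, n * (densityMeasure m ι p).real (euclBall ι x R) ≤ V) (hl : 0 < l)
    (hlV : l ≤ 2 * V) :
    P {w | l ≤ |∑ c ∈ ({i} : Finset (Fin n))ᶜ,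
        ((euclBall ι (X i w) R).indicator (fun _ => (1 : ℝ)) (X c w) -
          (densityMeasure m ι p).real (euclBall ι (X i w) R))|} ≤
      ENNReal.ofReal (2 * Real.exp (-(l ^ 2 / (4 * V)))) := by
  let S : Finset (Fin n) := {i}
  let i' : S := ⟨i, by simp [S]⟩
  refine measure_abs_sum_random_set_ge_le hX hind hlaw S
    (A := {q : (S → M) × M | dist (ι (q.1 i')) (ι q.2) ≤ R}) ?_ (V := V) (fun y => ?_) hl hlV
  · exact measurableSet_le ((hι.measurable.comp
      ((measurable_pi_apply i').comp measurable_fst)).dist (hι.measurable.comp measurable_snd))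
      measurable_const
  · rw [Fintype.card_fin]
    exact hV (y i')

theorem measure_overlap_deviation_le (hι : Continuous ι) (hX : ∀ i, Measurable (X i))
    (hind : iIndepFun X P) (hlaw : ∀ i, P.map (X i) = densityMeasure m ι p) (j i a b : Fin n)
    {R V l : ℝ} (hV : ∀ x, n * (densityMeasure m ι p).real (euclBall ι x R) ≤ V) (hl : 0 < l)
    (hlV : l ≤ 2 * V) :
    P {w | dist (ι (X a w)) (ι (X j w)) ≤ R ∧ dist (ι (X b w)) (ι (X i w)) ≤ R ∧
        l ≤ |∑ c ∈ ({j, i, a, b} : Finset (Fin n))ᶜ,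
        ((euclBall ι (X j w) (dist (ι (X a w)) (ι (X j w))) ∩
          euclBall ι (X i w) (dist (ι (X b w)) (ι (X i w)))).indicator (fun _ => (1 : ℝ)) (X c w) -
        (densityMeasure m ι p).real (euclBall ι (X j w) (dist (ι (X a w)) (ι (X j w))) ∩
          euclBall ι (X i w) (dist (ι (X b w)) (ι (X i w)))))|} ≤
      ENNReal.ofReal (2 * Real.exp (-(l ^ 2 / (4 * V)))) := by
  let S : Finset (Fin n) := {j, i, a, b}
  let j' : S := ⟨j, by simp [S]⟩
  let i' : S := ⟨i, by simp [S]⟩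
  let a' : S := ⟨a, by simp [S]⟩
  let b' : S := ⟨b, by simp [S]⟩
  -- The constraint that both radii are at most `R` is built in, so that every section has mass at
  -- most `V / n`: it is empty when the constraint fails.
  let A : Set ((S → M) × M) := {q | (dist (ι (q.1 a')) (ι (q.1 j')) ≤ R ∧
    dist (ι (q.1 b')) (ι (q.1 i')) ≤ R) ∧
    (dist (ι (q.1 j')) (ι q.2) ≤ dist (ι (q.1 a')) (ι (q.1 j')) ∧
    dist (ι (q.1 i')) (ι q.2) ≤ dist (ι (q.1 b')) (ι (q.1 i')))}
  have hf : ∀ s : S, Measurable fun q : (S → M) × M => ι (q.1 s) := fun s =>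
    hι.measurable.comp ((measurable_pi_apply s).comp measurable_fst)
  have hs : Measurable fun q : (S → M) × M => ι q.2 := hι.measurable.comp measurable_snd
  have hA : MeasurableSet A :=
    ((measurableSet_le ((hf a').dist (hf j')) measurable_const).inter
      (measurableSet_le ((hf b').dist (hf i')) measurable_const)).inter
    ((measurableSet_le ((hf j').dist hs) ((hf a').dist (hf j'))).inter
      (measurableSet_le ((hf i').dist hs) ((hf b').dist (hf i'))))
  refine (measure_mono ?_).trans (measure_abs_sum_random_set_ge_le hX hind hlaw S hA (V := V)
    (fun y => ?_) hl hlV)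
  · rintro w ⟨h1, h2, h3⟩
    have hset : Prod.mk (fun s : S => X s w) ⁻¹' A =
        euclBall ι (X j w) (dist (ι (X a w)) (ι (X j w))) ∩
          euclBall ι (X i w) (dist (ι (X b w)) (ι (X i w))) := by
      ext z
      exact ⟨fun h => h.2, fun h => ⟨⟨h1, h2⟩, h⟩⟩
    have hindic : ∀ z, A.indicator (fun _ => (1 : ℝ)) (fun s : S => X s w, z) =
        (euclBall ι (X j w) (dist (ι (X a w)) (ι (X j w))) ∩
          euclBall ι (X i w) (dist (ι (X b w)) (ι (X i w)))).indicator (fun _ => (1 : ℝ)) z := by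
      intro z
      rw [← hset]
      rfl
    simp only [mem_ofPred_eq, hset, hindic]
    exact h3
  · rw [Fintype.card_fin]
    refine le_trans ?_ (hV (y j'))
    gcongr
    · exact measure_ne_top _ _
    · rintro z ⟨⟨h1, -⟩, h2, -⟩
      exact le_trans h2 h1

end Events

/-! ### Operator bounds on a fixed sample. -/

section Deterministic

variable {m d n k : ℕ} {M : Type*} [TopologicalSpace M]
  [ChartedSpace (EuclideanSpace ℝ (Fin m)) M] [MeasurableSpace M]
  {ι : M → EuclideanSpace ℝ (Fin d)} {p : M → ℝ}
  [IsProbabilityMeasure (densityMeasure m ι p)]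
  {r₁ C D B δ b : ℝ} {f : M → ℝ}

/-- Crude estimate for `k/n` bounded below: count and weight term both lie in `[0, n]`, and
increments are controlled by the diameter. -/
theorem abs_snnLaplacian_sub_L1_le_diam {X : Fin n → M}
    (hG : GeodesicBounds m ι r₁ C D) (hι : Function.Injective ι)
    (hpm : Measurable p) (hp : ∀ x, 0 < p x) (hf : IsLip (m := m) ι f)
    (hk : k ≠ 0) (hn : n ≠ 0) (j : Fin n) :
    |snnLaplacian m ι k X (fun i => f (X i)) j - L1 (m := m) ι p k X (fun i => f (X i)) j| ≤
      (unitBallVol m * n / k) ^ (1 + 2 / (m : ℝ)) / (2 ^ (m + 2) * k * n) *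
        (n * (n * (lipSeminorm (m := m) ι f univ * D))) := by
  refine (abs_snnLaplacian_sub_L1_le hn hk (fun i => f (X i)) j (I := Finset.univ) (E := n)
    (U := lipSeminorm (m := m) ι f univ * D) (by positivity) (by simp) ?_ ?_).trans ?_
  · intro i _
    have h1 : (sharedCount ι k X (X j) (X i) : ℝ) ≤ n := by exact_mod_cast sharedCount_le _ _
    have h2 := wk_nonneg (m := m) (ι := ι) (k := k) (X := X) hp (X j) (X i)
    have h3 := wk_le_one (m := m) (ι := ι) (k := k) (X := X) hpm hp (X j) (X i)
    have h4 : (0 : ℝ) ≤ n := by positivity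
    have h5 : (0 : ℝ) ≤ sharedCount ι k X (X j) (X i) := by positivity
    rw [abs_le]
    constructor <;> nlinarith
  · intro i _
    refine (abs_sub_le_lipSeminorm hG hι hf (mem_univ _) (mem_univ _)).trans ?_
    exact mul_le_mul_of_nonneg_left (hG.le_diam _ _) (lipSeminorm_nonneg _)
  · rw [Finset.card_univ, Fintype.card_fin]

variable [BorelSpace M]

/-- With all radii at most `R`, points at chord above `2R` share nothing with `x_j`. For the rest,
`hRC` bounds the geodesic distance by `2R(1+δ) < L`, so `f` is seen only in the ball of radius `L`.
-/
theorem abs_snnLaplacian_sub_L1_le_of_overlap {X : Fin n → M}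
    (hS : SampleBounds m ι p r₁ C D B δ b) (hι : Function.Injective ι)
    (hpm : Measurable p) (hp : ∀ x, 0 < p x) (hf : IsLip (m := m) ι f)
    (hX : Function.Injective X) (hk : 1 ≤ k) (hn : n ≠ 0) {R L l N : ℝ} (hR0 : 0 < R) (hl : 0 ≤ l)
    (hR : 2 * R < r₁) (hRC : 4 * C * R ^ 2 ≤ δ) (hRL : 2 * R * (1 + δ) < L)
    (hball : ∀ i, k ≤ ballCount ι X (X i) R) {j : Fin n}
    (hcard : (ballCount ι X (X j) (2 * R) : ℝ) ≤ N)
    (hov : ∀ i a b, dist (ι (X a)) (ι (X j)) ≤ R → dist (ι (X b)) (ι (X i)) ≤ R →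
      |∑ c ∈ ({j, i, a, b} : Finset (Fin n))ᶜ,
        ((euclBall ι (X j) (dist (ι (X a)) (ι (X j))) ∩
          euclBall ι (X i) (dist (ι (X b)) (ι (X i)))).indicator (fun _ => (1 : ℝ)) (X c) -
        (densityMeasure m ι p).real (euclBall ι (X j) (dist (ι (X a)) (ι (X j))) ∩
          euclBall ι (X i) (dist (ι (X b)) (ι (X i)))))| ≤ l) :
    |snnLaplacian m ι k X (fun i => f (X i)) j - L1 (m := m) ι p k X (fun i => f (X i)) j| ≤
      (unitBallVol m * n / k) ^ (1 + 2 / (m : ℝ)) / (2 ^ (m + 2) * k * n) *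
        (N * ((l + 8 + n * (2 * (B * R ^ (m + 2)))) *
          (lipSeminorm (m := m) ι f (geodBall (m := m) ι (X j) L) * L))) := by
  classical
  have hG := hS.geodesic
  have hB := hS.B_pos
  have hα := unitBallVol_pos m
  set Λ := lipSeminorm (m := m) ι f (geodBall (m := m) ι (X j) L)
  have hΛ : 0 ≤ Λ := lipSeminorm_nonneg _
  have hC := hG.C_pos
  have hδ : 0 ≤ δ := le_trans (by positivity) hRC
  have hL : 0 < L := lt_trans (by positivity) hRL
  let I : Finset (Fin n) := Finset.univ.filter fun i =>
    0 < dist (ι (X i)) (ι (X j)) ∧ dist (ι (X i)) (ι (X j)) ≤ 2 * R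
  have hI : (I.card : ℝ) = ballCount ι X (X j) (2 * R) := by
    rw [ballCount, ← ncard_coe_finset]
    simp [I]
  have hself : X j ∈ geodBall (m := m) ι (X j) L := by
    have := hG.le_add_cube (X j) (X j) (by rw [dist_self]; exact hG.r₁_pos)
    rw [dist_self] at this
    change geodDist (m := m) ι (X j) (X j) < L
    linarith
  have hgeod : ∀ i ∈ I, geodDist (m := m) ι (X j) (X i) < L := by
    intro i hi
    have hi := (Finset.mem_filter.1 hi).2.2
    rw [dist_comm] at hi
    have h1 := hG.le_add_cube (X j) (X i) (hi.trans_lt hR)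
    have h2 : C * dist (ι (X j)) (ι (X i)) ^ 3 ≤ C * (2 * R) ^ 3 := by gcongr
    nlinarith
  refine (abs_snnLaplacian_sub_L1_le hn (by omega) (fun i => f (X i)) j (I := I)
    (E := l + 8 + n * (2 * (B * R ^ (m + 2)))) (U := Λ * L) (by positivity) ?_ ?_ ?_).trans ?_
  · intro i hi hij
    have h1 : 2 * R < dist (ι (X j)) (ι (X i)) := by
      by_contra! h
      exact hi (Finset.mem_filter.2 ⟨Finset.mem_univ _, dist_pos.2 (hι.ne (hX.ne hij)),
        by rwa [dist_comm]⟩)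
    obtain ⟨hjR, a, ha0, ha⟩ := exists_knnRadius_eq hk hR0 (hball j)
    obtain ⟨hiR, a', ha0', ha'⟩ := exists_knnRadius_eq hk hR0 (hball i)
    have h2 : knnRadius ι k X (X j) + knnRadius ι k X (X i) < dist (ι (X j)) (ι (X i)) := by
      linarith
    exact ⟨by exact_mod_cast sharedCount_eq_zero h2,
      wk_eq_zero hpm hp hG (ha ▸ ha0) (ha' ▸ ha0') h2⟩
  · intro i _
    exact abs_sharedCount_sub_wk_le hS hpm hp hX hk hR0 (by linarith) hball (hov i)
  · intro i hi
    refine (abs_sub_le_lipSeminorm hG hι hf hself (hgeod i hi)).trans ?_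
    exact mul_le_mul_of_nonneg_left (hgeod i hi).le hΛ
  · rw [hI]
    gcongr

end Deterministic

/-! ### The good event and its probability. -/

section Probability

variable {m d n : ℕ} {M : Type*} [TopologicalSpace M]
  [ChartedSpace (EuclideanSpace ℝ (Fin m)) M] [CompactSpace M] [MeasurableSpace M] [BorelSpace M]
  {ι : M → EuclideanSpace ℝ (Fin d)} {p : M → ℝ}
  [IsProbabilityMeasure (densityMeasure m ι p)]
  {Ω : Type*} [MeasurableSpace Ω] {P : Measure Ω} [IsProbabilityMeasure P] {X : Fin n → Ω → M}

theorem ae_injective_sample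
    (hι : Manifold.IsSmoothEmbedding (𝓡 m) 𝓘(ℝ, EuclideanSpace ℝ (Fin d)) ∞ ι) (hm : m ≠ 0)
    (hX : ∀ i, Measurable (X i))
    (hind : iIndepFun X P) (hlaw : ∀ i, P.map (X i) = densityMeasure m ι p) :
    P {w | ¬ Function.Injective fun i => X i w} = 0 := by
  have hc := hι.isEmbedding.continuous
  have h1 : ∀ i j, i ≠ j → P {w | X i w = X j w} = 0 := by
    intro i j hij
    have h2 := measure_preimage_eq_zero_of_null hX hind hlaw hij
      (A := {q | ι q.1 = ι q.2}) (measurableSet_eq_fun (hc.measurable.comp measurable_fst)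
        (hc.measurable.comp measurable_snd)) ?_
    · exact measure_mono_null (fun w (hw : X i w = X j w) => congrArg ι hw) h2
    · intro y
      refine withDensity_absolutelyContinuous _ _ (measure_mono_null ?_ (vol_singleton hm hι y))
      exact fun z (hz : ι y = ι z) => (hι.isEmbedding.injective hz).symm
  refine measure_mono_null (t := ⋃ i, ⋃ j, ⋃ _ : i ≠ j, {w | X i w = X j w}) ?_
    (measure_iUnion_null fun i => measure_iUnion_null fun j => measure_iUnion_null (h1 i j))
  intro w hw
  simp only [Function.Injective, mem_ofPred_eq, not_forall] at hw
  obtain ⟨i, j, h, hij⟩ := hw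
  exact mem_iUnion.2 ⟨i, mem_iUnion.2 ⟨j, mem_iUnion.2 ⟨hij, h⟩⟩⟩

/-- With high probability the sample points are distinct and the numbers of sample points in balls,
and in intersections of two balls through sample points, are close to their expectations. -/
theorem measure_not_concentrated_le
    (hι : Manifold.IsSmoothEmbedding (𝓡 m) 𝓘(ℝ, EuclideanSpace ℝ (Fin d)) ∞ ι) (hm : m ≠ 0)
    (hX : ∀ i, Measurable (X i))
    (hind : iIndepFun X P) (hlaw : ∀ i, P.map (X i) = densityMeasure m ι p) (j : Fin n)
    {R R' V l s y : ℝ} (hRR' : R ≤ R')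
    (hV : ∀ x, n * (densityMeasure m ι p).real (euclBall ι x R') ≤ V)
    (hl : 0 < l) (hlV : l ≤ 2 * V) (hs : 0 < s) (hsV : s ≤ 2 * V)
    (hyl : y ≤ l ^ 2 / (4 * V)) (hys : y ≤ s ^ 2 / (4 * V)) :
    P {w | ¬ (Function.Injective (fun i => X i w) ∧
      (∀ i, |∑ c ∈ ({i} : Finset (Fin n))ᶜ,
        ((euclBall ι (X i w) R).indicator (fun _ => (1 : ℝ)) (X c w) -
          (densityMeasure m ι p).real (euclBall ι (X i w) R))| < s) ∧
      |∑ c ∈ ({j} : Finset (Fin n))ᶜ,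
        ((euclBall ι (X j w) R').indicator (fun _ => (1 : ℝ)) (X c w) -
          (densityMeasure m ι p).real (euclBall ι (X j w) R'))| < s ∧
      ∀ i a b, dist (ι (X a w)) (ι (X j w)) ≤ R → dist (ι (X b w)) (ι (X i w)) ≤ R →
        |∑ c ∈ ({j, i, a, b} : Finset (Fin n))ᶜ,
        ((euclBall ι (X j w) (dist (ι (X a w)) (ι (X j w))) ∩
          euclBall ι (X i w) (dist (ι (X b w)) (ι (X i w)))).indicator (fun _ => (1 : ℝ)) (X c w) -
        (densityMeasure m ι p).real (euclBall ι (X j w) (dist (ι (X a w)) (ι (X j w))) ∩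
          euclBall ι (X i w) (dist (ι (X b w)) (ι (X i w)))))| < l)} ≤
      ENNReal.ofReal (6 * n ^ 3 * Real.exp (-y)) := by
  have hc := hι.isEmbedding.continuous
  have hV' : ∀ x, n * (densityMeasure m ι p).real (euclBall ι x R) ≤ V := fun x => by
    refine le_trans ?_ (hV x)
    gcongr
    · exact measure_ne_top _ _
    · exact fun z hz => le_trans hz hRR'
  have hexp : ∀ {a : ℝ}, y ≤ a →
      ENNReal.ofReal (2 * Real.exp (-a)) ≤ ENNReal.ofReal (2 * Real.exp (-y)) := fun h => by
    gcongr
  have hn : (1 : ℝ) ≤ n := by exact_mod_cast j.pos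
  calc
    _ ≤ P ({w | ¬ Function.Injective fun i => X i w} ∪
        ((⋃ i, {w | s ≤ |∑ c ∈ ({i} : Finset (Fin n))ᶜ,
          ((euclBall ι (X i w) R).indicator (fun _ => (1 : ℝ)) (X c w) -
            (densityMeasure m ι p).real (euclBall ι (X i w) R))|}) ∪
        ({w | s ≤ |∑ c ∈ ({j} : Finset (Fin n))ᶜ,
          ((euclBall ι (X j w) R').indicator (fun _ => (1 : ℝ)) (X c w) -
            (densityMeasure m ι p).real (euclBall ι (X j w) R'))|} ∪
        ⋃ q : Fin n × Fin n × Fin n, {w | dist (ι (X q.2.1 w)) (ι (X j w)) ≤ R ∧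
          dist (ι (X q.2.2 w)) (ι (X q.1 w)) ≤ R ∧
          l ≤ |∑ c ∈ ({j, q.1, q.2.1, q.2.2} : Finset (Fin n))ᶜ,
          ((euclBall ι (X j w) (dist (ι (X q.2.1 w)) (ι (X j w))) ∩
            euclBall ι (X q.1 w) (dist (ι (X q.2.2 w)) (ι (X q.1 w)))).indicator
              (fun _ => (1 : ℝ)) (X c w) -
          (densityMeasure m ι p).real (euclBall ι (X j w) (dist (ι (X q.2.1 w)) (ι (X j w))) ∩
            euclBall ι (X q.1 w) (dist (ι (X q.2.2 w)) (ι (X q.1 w)))))|}))) := by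
        refine measure_mono fun w hw => ?_
        by_contra hcon
        simp only [mem_union, mem_iUnion, not_or, not_exists, Prod.forall, mem_ofPred_eq,
          not_and, not_le, not_not] at hcon
        exact hw ⟨hcon.1, hcon.2.1, hcon.2.2.1, hcon.2.2.2⟩
    _ ≤ 0 + (∑ _i : Fin n, ENNReal.ofReal (2 * Real.exp (-y)) +
        (ENNReal.ofReal (2 * Real.exp (-y)) +
          ∑ _q : Fin n × Fin n × Fin n, ENNReal.ofReal (2 * Real.exp (-y)))) := by
        refine (measure_union_le _ _).trans (add_le_add
          (ae_injective_sample hι hm hX hind hlaw).le ?_)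
        refine (measure_union_le _ _).trans (add_le_add ?_ ?_)
        · refine (measure_iUnion_fintype_le _ _).trans (Finset.sum_le_sum fun i _ => ?_)
          exact (measure_ballCount_deviation_le hc hX hind hlaw i hV' hs hsV).trans (hexp hys)
        refine (measure_union_le _ _).trans (add_le_add ?_ ?_)
        · exact (measure_ballCount_deviation_le hc hX hind hlaw j hV hs hsV).trans (hexp hys)
        · refine (measure_iUnion_fintype_le _ _).trans (Finset.sum_le_sum fun q _ => ?_)
          exact (measure_overlap_deviation_le hc hX hind hlaw j q.1 q.2.1 q.2.2 hV' hl hlV).trans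
            (hexp hyl)
    _ = ENNReal.ofReal ((n + 1 + n ^ 3) * (2 * Real.exp (-y))) := by
        rw [ENNReal.ofReal_mul (p := (n : ℝ) + 1 + n ^ 3) (by positivity),
          ENNReal.ofReal_add (by positivity) (by positivity),
          ENNReal.ofReal_add (by positivity) (by positivity), ENNReal.ofReal_pow (by positivity)]
        simp only [Finset.sum_const, Finset.card_univ, Fintype.card_prod, Fintype.card_fin,
          nsmul_eq_mul, ENNReal.ofReal_natCast, ENNReal.ofReal_one]
        push_cast
        ring
    _ ≤ _ := by
        -- Two tails and `n + 1 + n³ ≤ 3 n³` produce the constant 6 of the theorem.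
        refine ENNReal.ofReal_le_ofReal ?_
        have h1 : (n : ℝ) ≤ n ^ 3 := le_self_pow₀ hn (by norm_num)
        have h2 : (1 : ℝ) ≤ n ^ 3 := one_le_pow₀ hn
        nlinarith [Real.exp_pos (-y)]

end Probability

/-! ### Scales, constants and the localized estimate. -/

section Scale

variable {m k n : ℕ}

theorem epsStar_eq {M : Type*} {p : M → ℝ} {x₀ : M} (hp : 0 < p x₀) (hmin : ∀ x, p x₀ ≤ p x) :
    epsStar m p k n =
      (1 / (unitBallVol m * p x₀)) ^ (1 / (m : ℝ)) * ((k : ℝ) / n) ^ (1 / (m : ℝ)) := by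
  have hα := unitBallVol_pos m
  rw [← Real.mul_rpow (by positivity) (by positivity), one_div_mul_eq_div]
  have hle : ∀ x, ((k : ℝ) / n / (unitBallVol m * p x)) ^ (1 / (m : ℝ)) ≤
      ((k : ℝ) / n / (unitBallVol m * p x₀)) ^ (1 / (m : ℝ)) := fun x => by
    have hx := hmin x
    have : 0 < p x := hp.trans_le hx
    gcongr
  have : Nonempty M := ⟨x₀⟩
  exact le_antisymm (ciSup_le hle) (le_ciSup ⟨_, forall_mem_range.2 hle⟩ x₀)

theorem rpow_one_add_two_div (hm : m ≠ 0) {α ε : ℝ} (hα : 0 < α) (hε : 0 < ε) (hn : 0 < n)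
    (hk : 0 < k) (h : ε ^ m = (k : ℝ) / n) :
    (α * n / k) ^ (1 + 2 / (m : ℝ)) = α ^ (1 + 2 / (m : ℝ)) / ε ^ (m + 2) := by
  have hm' : (m : ℝ) ≠ 0 := by exact_mod_cast hm
  have h1 : α * n / k = α / ε ^ m := by rw [h]; field_simp
  rw [h1, Real.div_rpow hα.le (by positivity), ← Real.rpow_natCast ε m, ← Real.rpow_mul hε.le,
    ← Real.rpow_natCast ε (m + 2)]
  congr 2
  push_cast
  field_simp

/-- Either the probability bound is trivial, or `n` is at most exponentially large. -/
theorem half_le_of_lt_one {n : ℕ} (hn : 2 ≤ n) {z : ℝ} (h : n * Real.exp (-z) < 1) : 1 / 2 ≤ z := by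
  by_contra! hz
  have h1 : Real.exp z < 2 := by
    have h2 : Real.exp z ^ 2 ≤ Real.exp 1 := by
      rw [← Real.exp_nat_mul]
      exact Real.exp_le_exp.2 (by push_cast; linarith)
    nlinarith [Real.exp_one_lt_d9, Real.exp_pos z]
  rw [Real.exp_neg, ← div_eq_mul_inv, div_lt_one (Real.exp_pos z)] at h
  have : (2 : ℝ) ≤ n := by exact_mod_cast hn
  linarith

end Scale

variable {m d : ℕ} {M : Type*} [TopologicalSpace M]
  [ChartedSpace (EuclideanSpace ℝ (Fin m)) M] [MeasurableSpace M] [BorelSpace M]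
  {ι : M → EuclideanSpace ℝ (Fin d)} {p : M → ℝ}
  [IsProbabilityMeasure (densityMeasure m ι p)]
  {r₁ C D B δ b : ℝ}

theorem abs_snnLaplacian_sub_L1_le_of_concentrated (hm : m ≠ 0)
    (hι : Function.Injective ι) (hpm : Measurable p) (hp : ∀ x, 0 < p x)
    (hδ : 0 < δ) (hδ1 : δ ≤ 1) (hS : SampleBounds m ι p r₁ C D B δ b)
    {A : ℝ} (hA : 2 * (1 + δ) ^ 4 < A) {e ε R V c t : ℝ} (he : 0 < e)
    (hem : unitBallVol m * b * e ^ m = 1) {n k : ℕ} (hk : 1 ≤ k) (hkn : k < n) (hε : 0 < ε)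
    (hεm : ε ^ m = (k : ℝ) / n) (hεδ : ε ^ m ≤ δ / 4) (hR : R = (1 + δ) ^ 3 * (e * ε))
    (hRr : 2 * R < r₁) (hRC : 4 * C * R ^ 2 ≤ δ) (hεt : ε ≤ t) (hc : 1 ≤ c * (k * ε * t))
    {X : Fin n → M} {j : Fin n}
    (hV : n * (densityMeasure m ι p).real (euclBall ι (X j) (2 * R)) ≤ V * k)
    (hX : Function.Injective X)
    (hball : ∀ i, |∑ c ∈ ({i} : Finset (Fin n))ᶜ,
      ((euclBall ι (X i) R).indicator (fun _ => (1 : ℝ)) (X c) -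
        (densityMeasure m ι p).real (euclBall ι (X i) R))| < δ / 2 * k)
    (hball' : |∑ c ∈ ({j} : Finset (Fin n))ᶜ,
      ((euclBall ι (X j) (2 * R)).indicator (fun _ => (1 : ℝ)) (X c) -
        (densityMeasure m ι p).real (euclBall ι (X j) (2 * R)))| < δ / 2 * k)
    (hov : ∀ i a b, dist (ι (X a)) (ι (X j)) ≤ R → dist (ι (X b)) (ι (X i)) ≤ R →
      |∑ c ∈ ({j, i, a, b} : Finset (Fin n))ᶜ,
        ((euclBall ι (X j) (dist (ι (X a)) (ι (X j))) ∩
          euclBall ι (X i) (dist (ι (X b)) (ι (X i)))).indicator (fun _ => (1 : ℝ)) (X c) -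
        (densityMeasure m ι p).real (euclBall ι (X j) (dist (ι (X a)) (ι (X j))) ∩
          euclBall ι (X i) (dist (ι (X b)) (ι (X i)))))| < k * ε * t)
    {f : M → ℝ} (hf : IsLip (m := m) ι f) :
    |snnLaplacian m ι k X (fun i => f (X i)) j - L1 (m := m) ι p k X (fun i => f (X i)) j| ≤
      unitBallVol m ^ (1 + 2 / (m : ℝ)) / 2 ^ (m + 2) * ((V + 1) *
        (1 + 8 * c + 2 * B * ((1 + δ) ^ 3 * e) ^ (m + 2)) * (A * e)) *
        lipSeminorm (m := m) ι f (geodBall (m := m) ι (X j) (A * (e * ε))) * t := by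
  have hB := hS.B_pos
  have hα := unitBallVol_pos m
  have hn0 : (0 : ℝ) < n := by exact_mod_cast (by omega : 0 < n)
  have hk1 : (1 : ℝ) ≤ k := by exact_mod_cast hk
  have hk0 : (0 : ℝ) < k := by linarith
  have hn1 : (1 : ℝ) ≤ n := by exact_mod_cast (by omega : 1 ≤ n)
  have hnε : n * ε ^ m = k := by rw [hεm]; field_simp
  have hR0 : 0 < R := by rw [hR]; positivity
  have ht : 0 < t := hε.trans_le hεt
  have hA0 : 0 < A := lt_trans (by positivity) hA
  have hV0 : 0 ≤ V := nonneg_of_mul_nonneg_left (le_trans (by positivity) hV) hk0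
  -- Of the three factors `1 + δ` in `R`, one enlarges the ball, one pays the volume distortion, and
  -- one leaves a surplus.
  have hlow : ∀ x, (1 + δ) * ε ^ m ≤ (densityMeasure m ι p).real (euclBall ι x R) := by
    intro x
    have h2 : (1 + δ) * ((1 + δ) ^ 2 * (e * ε)) = R := by rw [hR]; ring
    have h1 := hS.le_ball x ((1 + δ) ^ 2 * (e * ε)) (by positivity)
      (by nlinarith [show 0 < (1 + δ) ^ 2 * (e * ε) by positivity])
    have h3 : b * (unitBallVol m * ((1 + δ) ^ 2 * (e * ε)) ^ m) =
        (1 + δ) ^ m * ((1 + δ) ^ m * ε ^ m) := by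
      rw [mul_pow, mul_pow, ← pow_mul, mul_comm 2 m, pow_mul, pow_two]
      linear_combination ((1 + δ) ^ m * (1 + δ) ^ m * ε ^ m) * hem
    rw [h2, h3] at h1
    refine le_trans ?_ (le_of_mul_le_mul_left h1 (by positivity))
    gcongr
    exact le_self_pow₀ (by linarith) hm
  have hcard : ∀ i : Fin n, ((({i} : Finset (Fin n))ᶜ.card : ℕ) : ℝ) = n - 1 := by
    intro i
    rw [Finset.card_compl, Finset.card_singleton, Fintype.card_fin, Nat.cast_sub (by omega),
      Nat.cast_one]
  have h1 := abs_snnLaplacian_sub_L1_le_of_overlap (N := (V + 1) * k) (L := A * (e * ε))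
    (l := k * ε * t) (j := j) hS hι hpm hp hf hX hk (by omega) hR0 (by positivity) hRr hRC
    ?_ ?_ ?_ (fun i a b ha hb => (hov i a b ha hb).le)
  · refine h1.trans ?_
    have hΛ : 0 ≤ lipSeminorm (m := m) ι f (geodBall (m := m) ι (X j) (A * (e * ε))) :=
      lipSeminorm_nonneg _
    generalize lipSeminorm (m := m) ι f (geodBall (m := m) ι (X j) (A * (e * ε))) = Λ at hΛ ⊢
    -- `hc` absorbs the `8`, and `ε ≤ t` absorbs the bias of order `k ε²`.
    have hE : k * ε * t + 8 + n * (2 * (B * R ^ (m + 2))) ≤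
        (1 + 8 * c + 2 * B * ((1 + δ) ^ 3 * e) ^ (m + 2)) * (k * ε * t) := by
      have h2 : n * (2 * (B * R ^ (m + 2))) =
          2 * B * ((1 + δ) ^ 3 * e) ^ (m + 2) * (k * ε * ε) := by
        rw [hR, ← hnε, ← mul_assoc _ e ε, mul_pow _ ε]; ring
      have h3 : 2 * B * ((1 + δ) ^ 3 * e) ^ (m + 2) * (k * ε * ε) ≤
          2 * B * ((1 + δ) ^ 3 * e) ^ (m + 2) * (k * ε * t) := by gcongr
      rw [h2]
      linarith
    generalize (1 + 8 * c + 2 * B * ((1 + δ) ^ 3 * e) ^ (m + 2)) = K at hE ⊢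
    rw [rpow_one_add_two_div hm hα hε (by omega) (by omega) hεm]
    -- The powers of `ε` and `k` cancel up to `k / (n ε^m) = 1`.
    calc _ ≤ unitBallVol m ^ (1 + 2 / (m : ℝ)) / ε ^ (m + 2) / (2 ^ (m + 2) * k * n) *
          ((V + 1) * k * (K * (k * ε * t) * (Λ * (A * (e * ε))))) := by gcongr
      _ = unitBallVol m ^ (1 + 2 / (m : ℝ)) / 2 ^ (m + 2) * ((V + 1) * K * (A * e)) * Λ * t *
          (k / (n * ε ^ m)) := by rw [pow_add ε m 2]; field_simp
      _ = _ := by rw [hnε, div_self hk0.ne', mul_one]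
  · rw [show 2 * R * (1 + δ) = 2 * (1 + δ) ^ 4 * (e * ε) by rw [hR]; ring]
    gcongr
  · intro i
    have h2 := (abs_lt.1 (hball i)).1
    rw [Finset.sum_sub_distrib, ← ballCount_eq_sum hι hX, Finset.sum_const, nsmul_eq_mul,
      hcard] at h2
    have h3 : ((n : ℝ) - 1) * ((1 + δ) * ε ^ m) ≤
        (n - 1) * (densityMeasure m ι p).real (euclBall ι (X i) R) :=
      mul_le_mul_of_nonneg_left (hlow _) (by linarith)
    -- The loss from having `n - 1` other points is at most `δ/2 ≤ δk/2`; together with the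
    -- deviation it uses up the surplus `δk`.
    have h5 : (1 + δ) * ε ^ m ≤ 2 * (δ / 4) := by gcongr; linarith
    have h6 : ((n : ℝ) - 1) * ((1 + δ) * ε ^ m) = (1 + δ) * k - (1 + δ) * ε ^ m := by
      rw [← hnε]; ring
    have h7 : δ * 1 ≤ δ * k := by gcongr
    have h4 : (k : ℝ) ≤ ballCount ι X (X i) R := by linarith
    exact_mod_cast h4
  · have h2 := (abs_lt.1 hball').2
    rw [Finset.sum_sub_distrib, ← ballCount_eq_sum hι hX, Finset.sum_const, nsmul_eq_mul,
      hcard] at h2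
    have h4 : 0 ≤ (densityMeasure m ι p).real (euclBall ι (X j) (2 * R)) := measureReal_nonneg
    have h5 : δ / 2 * k ≤ 1 * k := by gcongr; linarith
    linarith

theorem exists_localized_bound [CompactSpace M] (hm : m ≠ 0)
    (hι : Manifold.IsSmoothEmbedding (𝓡 m) 𝓘(ℝ, EuclideanSpace ℝ (Fin d)) ∞ ι)
    (hpm : Measurable p) (hp : ∀ x, 0 < p x) {x₀ : M} (hmin : ∀ x, p x₀ ≤ p x)
    (hδ : 0 < δ) (hδ1 : δ ≤ 1) (hS : SampleBounds m ι p r₁ C D B δ (p x₀))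
    {A : ℝ} (hA : 2 * (1 + δ) ^ 4 < A) :
    ∃ Cp cp κ : ℝ, 0 < Cp ∧ 0 < cp ∧ 0 < κ ∧
    ∀ (Ω : Type*) [MeasurableSpace Ω] (P : Measure Ω) [IsProbabilityMeasure P]
      (n k : ℕ) (_ : 1 ≤ k) (_ : k < n)
      (X : Fin n → Ω → M) (_ : ∀ i, Measurable (X i)) (_ : iIndepFun X P)
      (_ : ∀ i, P.map (X i) = densityMeasure m ι p)
      (f : M → ℝ) (_ : IsLip (m := m) ι f) (j : Fin n)
      (t : ℝ) (_ : ((k : ℝ) / n) ^ (1 / (m : ℝ)) ≤ t) (_ : t ≤ ((k : ℝ) / n) ^ (-(1 / (m : ℝ))))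
      (_ : (k : ℝ) / n ≤ κ),
      P {s | Cp * lipSeminorm (m := m) ι f
                (geodBall (m := m) ι (X j s) (A * epsStar m p k n)) * t <
            |snnLaplacian m ι k (fun i => X i s) (fun i => f (X i s)) j
              - L1 (m := m) ι p k (fun i => X i s) (fun i => f (X i s)) j|}
          ≤ ENNReal.ofReal
            (6 * n * Real.exp (-(cp * k * ((k : ℝ) / n) ^ (2 / (m : ℝ)) * t ^ 2))) := by
  have hG := hS.geodesic
  have hr₁ := hG.r₁_pos
  have hC := hG.C_pos
  have hB := hS.B_pos
  have hα := unitBallVol_pos m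
  have hb := hp x₀
  have hA0 : 0 < A := lt_trans (by positivity) hA
  obtain ⟨e, he_def⟩ : ∃ e, e = (1 / (unitBallVol m * p x₀)) ^ (1 / (m : ℝ)) := ⟨_, rfl⟩
  have he : 0 < e := by rw [he_def]; positivity
  have hem : unitBallVol m * p x₀ * e ^ m = 1 := by
    rw [he_def, one_div (m : ℝ), Real.rpow_inv_natCast_pow (by positivity) hm]
    field_simp
  obtain ⟨g, hg_def⟩ : ∃ g, g = (1 + δ) ^ 3 * e := ⟨_, rfl⟩
  have hg : 0 < g := by rw [hg_def]; positivity
  obtain ⟨ε₀, hε₀, hε₀r, hε₀C⟩ : ∃ ε₀ > 0, ε₀ ≤ r₁ / (4 * g) ∧ ε₀ ≤ δ / (4 * C * g ^ 2) :=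
    ⟨min (r₁ / (4 * g)) (δ / (4 * C * g ^ 2)), by positivity, min_le_left _ _, min_le_right _ _⟩
  obtain ⟨V, hV1, hVB⟩ : ∃ V, 1 ≤ V ∧ B * (2 * g) ^ m ≤ V :=
    ⟨max 1 (B * (2 * g) ^ m), le_max_left _ _, le_max_right _ _⟩
  have hV0 : 0 < V := by linarith
  -- Chosen so that `3ck` is the Bernstein exponent of the deviation `δk/2`; the factor 3 will pay
  -- for the union bound.
  obtain ⟨c, hc_def⟩ : ∃ c, c = δ ^ 2 / (48 * V) := ⟨_, rfl⟩
  have hc : 0 < c := by rw [hc_def]; positivity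
  refine ⟨unitBallVol m ^ (1 + 2 / (m : ℝ)) / 2 ^ (m + 2) * ((V + 1) *
    (1 + 8 * (2 * c) + 2 * B * ((1 + δ) ^ 3 * e) ^ (m + 2)) * (A * e)), c,
    min (δ / 4) (ε₀ ^ m), by positivity, hc, by positivity, ?_⟩
  intro Ω _ P _ n k hk hkn X hX hind hlaw f hf j t ht1 ht2 hκ
  have hn0 : (0 : ℝ) < n := by exact_mod_cast (by omega : 0 < n)
  have hk0 : (0 : ℝ) < k := by exact_mod_cast (by omega : 0 < k)
  have hkn' : (k : ℝ) < n := by exact_mod_cast hkn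
  have hq : (0 : ℝ) < k / n := by positivity
  have hq1 : (k : ℝ) / n ≤ 1 := (div_le_one hn0).2 hkn'.le
  rw [Real.rpow_neg hq.le] at ht2
  have hε2 : ((k : ℝ) / n) ^ (2 / (m : ℝ)) = (((k : ℝ) / n) ^ (1 / (m : ℝ))) ^ 2 := by
    rw [← Real.rpow_natCast, ← Real.rpow_mul hq.le]
    congr 1
    push_cast
    ring
  rw [epsStar_eq hb hmin, hε2, ← he_def]
  have hε : 0 < ((k : ℝ) / n) ^ (1 / (m : ℝ)) := by positivity
  have hεm : (((k : ℝ) / n) ^ (1 / (m : ℝ))) ^ m = (k : ℝ) / n := by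
    rw [one_div (m : ℝ), Real.rpow_inv_natCast_pow hq.le hm]
  have hε1 : ((k : ℝ) / n) ^ (1 / (m : ℝ)) ≤ 1 := Real.rpow_le_one hq.le hq1 (by positivity)
  generalize ((k : ℝ) / n) ^ (1 / (m : ℝ)) = ε at *
  have hεε₀ : ε ≤ ε₀ := by
    refine le_of_pow_le_pow_left₀ hm hε₀.le ?_
    rw [hεm]
    exact hκ.trans (min_le_right _ _)
  have hεt : ε * t ≤ 1 := by
    calc ε * t ≤ ε * ε⁻¹ := by gcongr
      _ = 1 := mul_inv_cancel₀ hε.ne'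
  have ht : 0 < t := hε.trans_le ht1
  obtain ⟨z, hz_def⟩ : ∃ z, z = k * ε ^ 2 * t ^ 2 := ⟨_, rfl⟩
  have hz0 : 0 ≤ z := by rw [hz_def]; positivity
  have hz1 : z ≤ k * ε * t := by
    rw [hz_def, show k * ε ^ 2 * t ^ 2 = k * ε * t * (ε * t) by ring]
    exact mul_le_of_le_one_right (by positivity) hεt
  have hεtk : k * ε * t ≤ k := by
    rw [mul_assoc]
    exact mul_le_of_le_one_right hk0.le hεt
  have hkV : (k : ℝ) ≤ V * k := le_mul_of_one_le_left hk0.le hV1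
  rw [show c * k * ε ^ 2 * t ^ 2 = c * z by rw [hz_def]; ring]
  -- In the nontrivial case `n e^(-cz) < 1`, which tames `n³` and also forces `cz ≥ 1/2`, making the
  -- additive `8` negligible.
  rcases le_or_gt 1 (n * Real.exp (-(c * z))) with htriv | hsmall
  · refine prob_le_one.trans ?_
    rw [← ENNReal.ofReal_one]
    exact ENNReal.ofReal_le_ofReal (by linarith)
  have hcz := half_le_of_lt_one (by omega) hsmall
  have hR4 : g * ε ≤ r₁ / 4 := by
    calc g * ε ≤ g * (r₁ / (4 * g)) := by gcongr; exact hεε₀.trans hε₀r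
      _ = r₁ / 4 := by field_simp
  have hRC : 4 * C * (g * ε) ^ 2 ≤ δ := by
    calc 4 * C * (g * ε) ^ 2 = 4 * C * g ^ 2 * (ε * ε) := by ring
      _ ≤ 4 * C * g ^ 2 * (δ / (4 * C * g ^ 2) * 1) := by gcongr; exact hεε₀.trans hε₀C
      _ = δ := by field_simp
  have hV : ∀ x, n * (densityMeasure m ι p).real (euclBall ι x (2 * (g * ε))) ≤ V * k := by
    intro x
    have h1 := hS.ball_le x (2 * (g * ε)) (by positivity) (by linarith)
    calc n * (densityMeasure m ι p).real (euclBall ι x (2 * (g * ε)))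
        ≤ n * (B * (2 * (g * ε)) ^ m) := by gcongr; exact h1
      _ = B * (2 * g) ^ m * (n * ε ^ m) := by rw [← mul_assoc 2 g ε, mul_pow]; ring
      _ = B * (2 * g) ^ m * k := by rw [hεm]; field_simp
      _ ≤ V * k := by gcongr
  have hδk : δ / 2 * k ≤ 1 * k := by gcongr; linarith
  have hgε : 0 < g * ε := by positivity
  have hbad := measure_not_concentrated_le hι hm hX hind hlaw j (R := g * ε) (R' := 2 * (g * ε))
    (V := V * k) (l := k * ε * t) (s := δ / 2 * k) (y := 3 * (c * z)) (by linarith) hV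
    (by positivity) (by linarith) (by positivity) (by linarith) ?_ ?_
  · refine (measure_mono fun w hw => ?_).trans
      (hbad.trans (ENNReal.ofReal_le_ofReal ?_))
    · rw [mem_ofPred_eq] at hw ⊢
      rintro ⟨hinj, hball, hball', hov⟩
      refine not_le.2 hw (abs_snnLaplacian_sub_L1_le_of_concentrated hm hι.isEmbedding.injective
        hpm hp hδ hδ1 hS hA he hem hk hkn hε hεm ?_ ?_ (by linarith) hRC ht1 ?_ (hV _) hinj hball
        hball' hov hf)
      · rw [hεm]
        exact hκ.trans (min_le_left _ _)
      · rw [hg_def, mul_assoc]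
      · have : c * z ≤ c * (k * ε * t) := by gcongr
        linarith
    · have hy : 0 < Real.exp (-(c * z)) := Real.exp_pos _
      have h1 : Real.exp (-(3 * (c * z))) = Real.exp (-(c * z)) ^ 3 := by
        rw [← Real.exp_nat_mul]
        congr 1
        push_cast
        ring
      rw [h1]
      generalize Real.exp (-(c * z)) = y at *
      have h2 : (n * y) ^ 2 ≤ 1 := pow_le_one₀ (by positivity) hsmall.le
      calc 6 * (n : ℝ) ^ 3 * y ^ 3 = 6 * n * y * (n * y) ^ 2 := by ring
        _ ≤ 6 * n * y * 1 := by gcongr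
        _ = 6 * n * y := mul_one _
  · calc 3 * (c * z) = δ ^ 2 * (z / (16 * V)) := by rw [hc_def]; ring
      _ ≤ 1 * (z / (4 * V)) := by
          gcongr
          · exact pow_le_one₀ hδ.le hδ1
          · norm_num
      _ = (k * ε * t) ^ 2 / (4 * (V * k)) := by rw [hz_def]; field_simp
  · calc 3 * (c * z) = δ ^ 2 / (16 * V) * z := by rw [hc_def]; ring
      _ ≤ δ ^ 2 / (16 * V) * k := by gcongr; exact hz1.trans hεtk
      _ = (δ / 2 * k) ^ 2 / (4 * (V * k)) := by field_simp; norm_num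

end SNN

/-! ### The theorem. -/

theorem lemma4p2 (m : ℕ) (hm : 2 ≤ m) :
    ∃ C : ℝ, 0 < C ∧
    ∀ (d : ℕ) (M : Type*) [TopologicalSpace M] [ChartedSpace (EuclideanSpace ℝ (Fin m)) M]
      [IsManifold (𝓡 m) ∞ M] [CompactSpace M] [ConnectedSpace M]
      [MeasurableSpace M] [BorelSpace M]
      (ι : M → EuclideanSpace ℝ (Fin d))
      (_ : Manifold.IsSmoothEmbedding (𝓡 m) 𝓘(ℝ, EuclideanSpace ℝ (Fin d)) ∞ ι)
      (p : M → ℝ) (_ : ContMDiff (𝓡 m) 𝓘(ℝ, ℝ) 2 p) (_ : ∀ x, 0 < p x)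
      (_ : IsProbabilityMeasure (SNN.densityMeasure m ι p))
      (A : ℝ) (_ : 2 < A),
    ∃ Cp cp κ : ℝ, 0 < Cp ∧ 0 < cp ∧ 0 < κ ∧
    ∀ (Ω : Type*) [MeasurableSpace Ω] (P : Measure Ω) [IsProbabilityMeasure P]
      (n k : ℕ) (_ : 1 ≤ k) (_ : k < n)
      (X : Fin n → Ω → M) (_ : ∀ i, Measurable (X i)) (_ : iIndepFun X P)
      (_ : ∀ i, P.map (X i) = SNN.densityMeasure m ι p)
      (f : M → ℝ) (_ : SNN.IsLip (m := m) ι f) (j : Fin n)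
      (t : ℝ) (_ : ((k : ℝ) / n) ^ (1 / (m : ℝ)) ≤ t) (_ : t ≤ ((k : ℝ) / n) ^ (-(1 / (m : ℝ)))),
      P {s | Cp * SNN.lipSeminorm (m := m) ι f Set.univ * t <
            |SNN.snnLaplacian m ι k (fun i => X i s) (fun i => f (X i s)) j
              - SNN.L1 (m := m) ι p k (fun i => X i s) (fun i => f (X i s)) j|}
          ≤ ENNReal.ofReal
            (C * n * Real.exp (-(cp * k * ((k : ℝ) / n) ^ (2 / (m : ℝ)) * t ^ 2)))
      ∧ ((k : ℝ) / n ≤ κ →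
        P {s | Cp * SNN.lipSeminorm (m := m) ι f
                (SNN.geodBall (m := m) ι (X j s) (A * SNN.epsStar m p k n)) * t <
            |SNN.snnLaplacian m ι k (fun i => X i s) (fun i => f (X i s)) j
              - SNN.L1 (m := m) ι p k (fun i => X i s) (fun i => f (X i s)) j|}
          ≤ ENNReal.ofReal
            (C * n * Real.exp (-(cp * k * ((k : ℝ) / n) ^ (2 / (m : ℝ)) * t ^ 2)))) := by
  refine ⟨6, by norm_num, fun d M _ _ _ _ _ _ _ ι hι p hpc hp hprob A hA => ?_⟩
  have hm0 : m ≠ 0 := by omega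
  have hcont : Continuous p := hpc.continuous
  obtain ⟨x₀, hmin⟩ : ∃ x₀, ∀ x, p x₀ ≤ p x := by
    obtain ⟨x₀, -, h⟩ := isCompact_univ.exists_isMinOn univ_nonempty hcont.continuousOn
    exact ⟨x₀, fun x => h (mem_univ x)⟩
  obtain ⟨x₁, hmax⟩ : ∃ x₁, ∀ x, p x ≤ p x₁ := by
    obtain ⟨x₁, -, h⟩ := isCompact_univ.exists_isMaxOn univ_nonempty hcont.continuousOn
    exact ⟨x₁, fun x => h (mem_univ x)⟩
  obtain ⟨δ, hδ, hδ1, hδA⟩ : ∃ δ : ℝ, 0 < δ ∧ δ ≤ 1 ∧ 2 * (1 + δ) ^ 4 < A := by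
    -- For `δ ≤ 1`, `2(1+δ)^4 ≤ 2 + 30δ`; dividing by 31 makes the inequality strict.
    refine ⟨min 1 ((A - 2) / 31), lt_min one_pos (by linarith), min_le_left _ _, ?_⟩
    have h1 : min 1 ((A - 2) / 31) ≤ 1 := min_le_left _ _
    have h2 : min 1 ((A - 2) / 31) ≤ (A - 2) / 31 := min_le_right _ _
    have h0 : 0 < min 1 ((A - 2) / 31) := lt_min one_pos (by linarith)
    set δ := min 1 ((A - 2) / 31)
    have h3 : δ ^ 2 ≤ δ := by nlinarith
    have h4 : δ ^ 3 ≤ δ := by nlinarith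
    have h5 : δ ^ 4 ≤ δ := by nlinarith
    nlinarith
  obtain ⟨r₁, C, D, B, hS⟩ := SNN.exists_sampleBounds hm0 hι (hp x₀) hmin hmax hδ
  obtain ⟨Cp, cp, κ, hCp, hcp, hκ, hloc⟩ :=
    SNN.exists_localized_bound hm0 hι hcont.measurable hp hmin hδ hδ1 hS hδA
  have hα := SNN.unitBallVol_pos m
  have hG := hS.geodesic
  have hinj := hι.isEmbedding.injective
  have hD : 0 ≤ D := (SNN.geodDist_nonneg ι x₀ x₀).trans (hG.le_diam x₀ x₀)
  refine ⟨max Cp ((SNN.unitBallVol m / κ) ^ (1 + 2 / (m : ℝ)) * D / κ ^ 2), cp, κ, lt_max_of_lt_left hCp, hcp, hκ, ?_⟩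
  intro Ω _ P _ n k hk hkn X hX hind hlaw f hf j t ht1 ht2
  have hn0 : (0 : ℝ) < n := by exact_mod_cast (by omega : 0 < n)
  have hk0 : (0 : ℝ) < k := by exact_mod_cast (by omega : 0 < k)
  have hq : (0 : ℝ) < k / n := by positivity
  have ht : 0 < t := lt_of_lt_of_le (by positivity) ht1
  refine ⟨?_, fun hqκ => (measure_mono fun s hs => ?_).trans
    (hloc Ω P n k hk hkn X hX hind hlaw f hf j t ht1 ht2 hqκ)⟩
  · rcases le_or_gt ((k : ℝ) / n) κ with hqκ | hqκ
    · refine (measure_mono fun s hs => ?_).trans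
        (hloc Ω P n k hk hkn X hX hind hlaw f hf j t ht1 ht2 hqκ)
      rw [mem_ofPred_eq] at hs ⊢
      refine lt_of_le_of_lt ?_ hs
      have h1 := SNN.lipSeminorm_mono hG hinj hf
        (subset_univ (SNN.geodBall (m := m) ι (X j s) (A * SNN.epsStar m p k n)))
      exact mul_le_mul_of_nonneg_right (mul_le_mul (le_max_left _ _) h1 (SNN.lipSeminorm_nonneg _)
        (le_max_of_le_left hCp.le)) ht.le
    -- For `k/n > κ` the event is empty: `n/k` is at most `1/κ` and `t ≥ κ`, so the diameter bound
    -- is already of order `t`.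
    · refine (measure_mono_null (t := ∅) (fun s hs => ?_) measure_empty).trans_le zero_le
      rw [mem_ofPred_eq] at hs
      refine absurd hs (not_lt.2 ?_)
      have hΛ := SNN.lipSeminorm_nonneg (m := m) (ι := ι) (f := f) univ
      refine (SNN.abs_snnLaplacian_sub_L1_le_diam hG hinj hcont.measurable hp hf (by omega)
        (by omega) j).trans ?_
      generalize SNN.lipSeminorm (m := m) ι f univ = Λ at hΛ ⊢
      have hκt : κ ≤ t := by
        refine hqκ.le.trans (le_trans ?_ ht1)
        calc (k : ℝ) / n = (k / n) ^ (1 : ℝ) := (Real.rpow_one _).symm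
          _ ≤ (k / n) ^ (1 / (m : ℝ)) := by
            refine Real.rpow_le_rpow_of_exponent_ge hq ?_ ?_
            · rw [div_le_one hn0]
              exact_mod_cast hkn.le
            · rw [div_le_one (by positivity)]
              exact_mod_cast (by omega : 1 ≤ m)
      have h1 : SNN.unitBallVol m * n / k ≤ SNN.unitBallVol m / κ := by
        rw [← div_div_eq_mul_div]
        gcongr
      have h2 : (n : ℝ) / k ≤ 1 / κ := by
        rw [← one_div_div]
        gcongr
      have h3 : (1 : ℝ) ≤ 2 ^ (m + 2) := one_le_pow₀ one_le_two
      have h4 : 1 ≤ t / κ := (one_le_div hκ).2 hκt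
      calc _ ≤ (SNN.unitBallVol m / κ) ^ (1 + 2 / (m : ℝ)) / (1 * k * n) *
            (n * (n * (Λ * D))) := by gcongr
        _ = (SNN.unitBallVol m / κ) ^ (1 + 2 / (m : ℝ)) * (n / k) * (Λ * D) * 1 := by
            field_simp
        _ ≤ (SNN.unitBallVol m / κ) ^ (1 + 2 / (m : ℝ)) * (1 / κ) * (Λ * D) * (t / κ) := by
            gcongr
        _ = (SNN.unitBallVol m / κ) ^ (1 + 2 / (m : ℝ)) * D / κ ^ 2 * Λ * t := by
            field_simp
        _ ≤ _ := by
            gcongr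
            exact le_max_right _ _
  · rw [mem_ofPred_eq] at hs ⊢
    refine lt_of_le_of_lt ?_ hs
    have h2 := SNN.lipSeminorm_nonneg (m := m) (ι := ι) (f := f)
      (SNN.geodBall (m := m) ι (X j s) (A * SNN.epsStar m p k n))
    gcongr
    exact le_max_left _ _
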